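/- All graphs are simple and undirected. The triangle graph $\mathcal T(G)$ of a graph $G$ has the triangles ($K_3$-subgraphs) of $G$ as its vertices, two distinct triangles being adjacent iff they share an edge. $K_n$, $C_n$, $P_n$ denote the complete graph, cycle and path on $n$ vertices; $W_n=K_1\vee C_n$ is the wheel (a cycle $C_n$ plus one vertex joined to all of it); $C_m^2$ is the square of $C_m$ (distinct vertices are adjacent iff their distance in $C_m$ is at most $2$); $K_n-H$ is $K_n$ with the edge set of a copy of $H$ deleted. *Weak edge splitting.* It applies to a graph $H$ together with a fixed set $S$ of triangles of $H$ (the cycle-triangles) that induces a cycle in $\mathcal T(H)$. If an edge $uv$ lies in exactly one cycle-triangle $uvx$, delete $uv$, add a new vertex $w$ and the edges $uw$, $wv$, $wx$, and replace $uvx$ in $S$ by $uwx$ and $wvx$. A graph obtained from $C_m^2$ ($m\ge 5$), respectively from $K_6-K_3$ or $K_6-P_4$, by $k$ weak edge splittings is a graph resulting from $k$ successive such operations, starting with any fixed set of triangles that induces a cycle of length $m$, respectively $6$, in the triangle graph. *Weak vertex sticking.* Two vertices $u,v$ at distance at least $3$ are removed and a new vertex adjacent to all of $N(u)\cup N(v)$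 is introduced. **Theorem.** Let $n\ge 3$ be an integer and $G$ a graph. Then $\mathcal T(G)$ contains no induced cycle of length $n$ if and only if $G$ has no (not necessarily induced) subgraph isomorphic to any of the following graphs. - (a) If $n=3$: $K_4$ and $K_5-K_3$. - (b) If $n=4$: $W_4$. - (c) If $n=5$: $W_5$ and $C_5^2\cong K_5$. - (d) If $n=6$: $W_6$, $C_6^2$, $K_6-K_3$, $K_6-P_4$, and the graph obtained from $C_5^2\cong K_5$ by one weak edge splitting. - (e) If $n\ge 7$: - (i) $W_n$; - (ii) the graphs obtained from $C_m^2$ by $n-m$ weak edge splittings, for $5\le m\le n$; - (iii) the graphs obtained from $K_6-K_3$ by $n-6$ weak edge splittings; - (iv) the graphs obtained from $K_6-P_4$ by $n-6$ weak edge splittings; - (v) the graphs obtained from any graph described in (ii)–(iv) by any number of weak vertex stickings. -/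

import Mathlib

open SimpleGraph

namespace TriangleGraphs

/-- The triangle graph of `G`: its vertices are the triangles of `G` (the `3`-cliques), and two
distinct triangles are adjacent iff they share an edge, i.e. have two distinct common vertices. -/
def triangleGraph {V : Type*} (G : SimpleGraph V) : SimpleGraph (G.cliqueSet 3) where
  Adj s t := s ≠ t ∧ ∃ a b : V, a ≠ b ∧
    a ∈ (s : Finset V) ∧ b ∈ (s : Finset V) ∧ a ∈ (t : Finset V) ∧ b ∈ (t : Finset V)
  symm := ⟨fun _ _ ⟨hne, a, b, hab, h1, h2, h3, h4⟩ => ⟨hne.symm, a, b, hab, h3, h4, h1, h2⟩⟩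
  loopless := ⟨fun _ h => h.1 rfl⟩

/-- The `k`-th power of `G`: distinct vertices are adjacent iff their distance in `G` is at most
`k` (vertices in different components have distance `⊤`). -/
def power {V : Type*} (G : SimpleGraph V) (k : ℕ) : SimpleGraph V where
  Adj u v := u ≠ v ∧ G.edist u v ≤ k
  symm := ⟨fun _ _ ⟨hne, h⟩ => ⟨hne.symm, by rwa [SimpleGraph.edist_comm]⟩⟩
  loopless := ⟨fun _ h => h.1 rfl⟩

/-- The join `G ∨ H`. -/
def join {V W : Type*} (G : SimpleGraph V) (H : SimpleGraph W) : SimpleGraph (V ⊕ W) :=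
  (G ⊕g H) ⊔ completeBipartiteGraph V W

/-- The complete graph `K_n`. -/
abbrev K (n : ℕ) : SimpleGraph (Fin n) := ⊤

/-- The wheel `W_n = K_1 ∨ C_n`. -/
def wheel (n : ℕ) : SimpleGraph (Fin 1 ⊕ Fin n) := join (K 1) (cycleGraph n)

/-- The square `C_n²` of the `n`-cycle. -/
def cycleSquare (n : ℕ) : SimpleGraph (Fin n) := power (cycleGraph n) 2

/-- `K_n - H`: the complete graph `K_n` minus the edge set of a copy of `H`, placed on the first
`k` vertices. -/
def completeMinus (n : ℕ) {k : ℕ} (hk : k ≤ n) (H : SimpleGraph (Fin k)) : SimpleGraph (Fin n) :=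
  K n \ H.map (Fin.castLE hk)

/-- `K_5 - K_3`. -/
def K5MinusK3 : SimpleGraph (Fin 5) := completeMinus 5 (by norm_num) (K 3)

/-- `K_6 - K_3`. -/
def K6MinusK3 : SimpleGraph (Fin 6) := completeMinus 6 (by norm_num) (K 3)

/-- `K_6 - P_4`, where `P_4` is the path with four vertices. -/
def K6MinusP4 : SimpleGraph (Fin 6) := completeMinus 6 (by norm_num) (pathGraph 4)

/-- `S` is a set of triangles of `G` that induces a cycle of length `n` in the triangle graph.
The members of such a fixed `S` are the cycle-triangles of `G`. -/
def IsInducedTriangleCycle {V : Type*} (n : ℕ) (G : SimpleGraph V) (S : Set (Finset V)) : Prop :=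
  S ⊆ G.cliqueSet 3 ∧
    Nonempty (cycleGraph n ≃g (triangleGraph G).induce {t : G.cliqueSet 3 | (t : Finset V) ∈ S})

/-- The graph in which the edge `uv` is replaced by the path `u w v` through a new vertex `w`
(here `none`), and the edge `wx` is added. -/
def splitEdge {V : Type*} (G : SimpleGraph V) (u v x : V) : SimpleGraph (Option V) :=
  (G.deleteEdges {s(u, v)}).map some ⊔
    fromEdgeSet {s(some u, none), s(none, some v), s(none, some x)}

open scoped Classical in
/-- The cycle-triangles after splitting `uv`: the cycle-triangle `uvx` is replaced by the two
triangles `uwx` and `wvx`. -/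
def splitTriangles {V : Type*} (S : Set (Finset V)) (u v x : V) : Set (Finset (Option V)) :=
  (fun t => t.map Function.Embedding.some) '' (S \ {{u, v, x}}) ∪
    {{some u, none, some x}, {none, some v, some x}}

open scoped Classical in
/-- The graph `H` with cycle-triangles `S'` arises, up to isomorphism, from the graph `G` with
cycle-triangles `S` by a weak edge splitting: some edge `uv` of `G` lies in exactly one
cycle-triangle `uvx`, and it is split. -/
def IsWeakEdgeSplitting {V W : Type*} (G : SimpleGraph V) (S : Set (Finset V))
    (H : SimpleGraph W) (S' : Set (Finset W)) : Prop :=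
  ∃ u v x : V, G.Adj u v ∧ {u, v, x} ∈ S ∧ (∀ t ∈ S, u ∈ t → v ∈ t → t = {u, v, x}) ∧
    ∃ f : splitEdge G u v x ≃g H,
      S' = (fun t => t.map f.toEquiv.toEmbedding) '' splitTriangles S u v x

/-- `ObtainedBySplittings m G k H S`: some induced `m`-cycle of the triangle graph of `G` is
fixed, and `k` successive weak edge splittings turn `G` into `H` (up to isomorphism), with
resulting cycle-triangles `S`. -/
inductive ObtainedBySplittings {V : Type} (m : ℕ) (G : SimpleGraph V) :
    ℕ → ∀ {W : Type}, SimpleGraph W → Set (Finset W) → Prop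
  | start {W : Type} {H : SimpleGraph W} {S : Set (Finset W)} :
      Nonempty (G ≃g H) → IsInducedTriangleCycle m H S → ObtainedBySplittings m G 0 H S
  | step {k : ℕ} {W X : Type} {H : SimpleGraph W} {S : Set (Finset W)} {H' : SimpleGraph X}
      {S' : Set (Finset X)} :
      ObtainedBySplittings m G k H S → IsWeakEdgeSplitting H S H' S' →
        ObtainedBySplittings m G (k + 1) H' S'

open scoped Classical in
/-- The map sending `u` and `v` to a new vertex (`none`) and fixing all other vertices. -/
noncomputable def stickMap {V : Type*} (u v a : V) : Option {a : V // a ≠ u ∧ a ≠ v} :=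
  if h : a ≠ u ∧ a ≠ v then some ⟨a, h⟩ else none

/-- The graph in which `u` and `v` are removed and a new vertex, adjacent to all of
`N(u) ∪ N(v)`, is introduced. -/
noncomputable def stickVertices {V : Type*} (G : SimpleGraph V) (u v : V) :
    SimpleGraph (Option {a : V // a ≠ u ∧ a ≠ v}) :=
  G.map (stickMap u v)

/-- `H` arises, up to isomorphism, from `G` by a weak vertex sticking: two vertices at distance
at least `3` are stuck together. -/
def IsWeakVertexSticking {V W : Type*} (G : SimpleGraph V) (H : SimpleGraph W) : Prop :=
  ∃ u v : V, 3 ≤ G.edist u v ∧ Nonempty (stickVertices G u v ≃g H)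

/-- `H` is obtained from `G` by any number (possibly zero) of weak vertex stickings. -/
inductive ObtainedByStickings {V : Type} (G : SimpleGraph V) :
    ∀ {W : Type}, SimpleGraph W → Prop
  | refl : ObtainedByStickings G G
  | step {W X : Type} {H : SimpleGraph W} {H' : SimpleGraph X} :
      ObtainedByStickings G H → IsWeakVertexSticking H H' → ObtainedByStickings G H'

/-- The graphs obtained by weak edge splittings from `C_m²` (`n - m` splittings, `5 ≤ m ≤ n`),
from `K_6 - K_3` or from `K_6 - P_4` (`n - 6` splittings). -/
def IsSplitForbidden (n : ℕ) {W : Type} (F : SimpleGraph W) : Prop :=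
  (∃ m, 5 ≤ m ∧ m ≤ n ∧ ∃ S, ObtainedBySplittings m (cycleSquare m) (n - m) F S) ∨
  (∃ S, ObtainedBySplittings 6 K6MinusK3 (n - 6) F S) ∨
  (∃ S, ObtainedBySplittings 6 K6MinusP4 (n - 6) F S)

end TriangleGraphs

/-! For n ≥ 4, an induced n-cycle of the triangle graph is a closed band of triangles c_0, ...,
c_{n-1}. Since c_{k-1} and c_{k+1} share no edge, each c_k has exactly one new vertex q_k, which
survives into c_{k+1}. Hence c_{k+1} = {q_{k+1}, q_k, z_k}, where z_{k+1} is q_k or z_k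
(`HasVertices.succ`). Call k core if q_k still lies in c_{k+2}. If nothing is core, z is constant
and a wheel appears. Otherwise the cyclic word of core and non-core letters defines an abstract
`Strip` on n vertices with two edges per triangle, and q maps its graph to G without identifying
edges (`wheel_or_strip`).

Deleting a non-core letter shortens the strip, and reinserting it is a weak edge splitting
(`Strip.isWeakEdgeSplitting_delete`). So only the number m of core letters matters
(`Strip.Proper.classification`). The values m = 1, 2 would give degenerate triangles or
non-consecutive triangles with a common edge. For m ≥ 5 all non-core letters can go, leaving C_m².
For m = 3 every gap between core letters is nonempty; keeping one letter in each leaves K_6 - K_3.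
For m = 4 two neighbouring gaps are nonempty; keeping one letter in each of them leaves K_6 - P_4.

Strip vertices with the same image in G have distance at least 3, so the image arises by weak vertex
stickings (`EdgeInjective.exists_stickings`), and these need at least eight vertices. Conversely, a
splitting lengthens the induced cycle by one, and edge-injective maps, among them subgraph
inclusions and stickings, preserve it. The case n = 3 is treated directly. -/

namespace TriangleGraphs

/-! ### Closed strips and their edges -/

/-- A closed strip of triangles, in which the vertex `k` is followed by `next k` and the `k`-th
triangle is `{next k, k, apex k}`. The core vertices are those that lie on at least three of the
triangles, and `apex k` is the last core vertex strictly before `k`. -/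
structure Strip (W : Type*) where
  next : W → W
  core : W → Bool
  apex : W → W
  apex_next : ∀ k, apex (next k) = bif core k then k else apex k
  transitive : ∀ s : Set W, s.Nonempty → (∀ k ∈ s, next k ∈ s) → s = Set.univ

namespace Strip

variable {W : Type*} (D : Strip W)

/-- The two edges of the triangle `{next k, k, apex k}` at `next k`. -/
def edge (b : Bool) (k : W) : Sym2 W := s(D.next k, bif b then D.apex k else k)

/-- The graph formed by the edges of a strip. -/
def graph : SimpleGraph W := fromEdgeSet {e | ∃ b k, e = D.edge b k}

open scoped Classical in
/-- The `k`-th triangle of a strip. -/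
noncomputable def tri (k : W) : Finset W := {D.next k, k, D.apex k}

/-- The edges of the strip are pairwise distinct and not loops. -/
structure Valid : Prop where
  not_isDiag : ∀ b k, ¬ (D.edge b k).IsDiag
  edge_inj : ∀ b k c l, D.edge b k = D.edge c l → b = c ∧ k = l

variable {D}

lemma mem_tri {k a : W} : a ∈ D.tri k ↔ a = D.next k ∨ a = k ∨ a = D.apex k := by
  simp [tri]

lemma graph_adj {a b : W} : D.graph.Adj a b ↔ (∃ c k, s(a, b) = D.edge c k) ∧ a ≠ b := by
  simp [graph]

lemma Valid.graph_adj (h : D.Valid) {a b : W} : D.graph.Adj a b ↔ ∃ c k, s(a, b) = D.edge c k := by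
  rw [Strip.graph_adj, and_iff_left_iff_imp]
  rintro ⟨c, k, hk⟩ rfl
  exact h.not_isDiag c k (hk ▸ rfl)

lemma next_surjective (D : Strip W) : Function.Surjective D.next := by
  intro k
  have := D.transitive (Set.range D.next) ⟨D.next k, k, rfl⟩ (fun a _ => ⟨a, rfl⟩)
  exact this.symm.subset (Set.mem_univ k)

lemma next_injective [Finite W] (D : Strip W) : Function.Injective D.next :=
  Finite.injective_iff_surjective.2 D.next_surjective

lemma induction (D : Strip W) {P : W → Prop} (k₀ : W) (h₀ : P k₀) (hs : ∀ k, P k → P (D.next k))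
    (k : W) : P k := by
  have := D.transitive {k | P k} ⟨k₀, h₀⟩ hs
  exact this.symm.subset (Set.mem_univ k)

lemma apex_next_of_core {k : W} (h : D.core k = true) : D.apex (D.next k) = k := by
  simp [D.apex_next, h]

lemma apex_next_of_not_core {k : W} (h : D.core k = false) : D.apex (D.next k) = D.apex k := by
  simp [D.apex_next, h]

/-- The apex changes only by becoming a core vertex. Just after `t` it is `t`, and transitivity
reaches every `k`. -/
lemma core_apex {t : W} (ht : D.core t = true) (k : W) : D.core (D.apex k) = true := by
  refine D.induction (P := fun k => D.core (D.apex k) = true) (D.next t) ?_ ?_ k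
  · rw [apex_next_of_core ht, ht]
  · intro k hk
    cases h : D.core k
    · rwa [apex_next_of_not_core h]
    · rwa [apex_next_of_core h]

/-- A fixed point of `next` would be the whole strip, leaving no room for the core vertex `t`. -/
lemma next_ne_of_not_core {t i : W} (ht : D.core t = true) (hi : D.core i = false) :
    D.next i ≠ i := by
  intro h
  have := D.induction (P := fun k => k = i) i rfl (by rintro k rfl; exact h) t
  simp [this, hi] at ht

/-- Every two vertices of a triangle of a strip form one of the edges of the strip. -/
lemma edge_of_mem_tri {k x y : W} (hx : x ∈ D.tri (D.next k)) (hy : y ∈ D.tri (D.next k))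
    (hxy : x ≠ y) : s(x, y) = D.edge false (D.next k) ∨ s(x, y) = D.edge true (D.next k) ∨
      s(x, y) = D.edge (!D.core k) k := by
  -- The third edge of a triangle is the one shared with the preceding triangle, and is listed
  -- there.
  have h3 : s(D.next k, D.apex (D.next k)) = D.edge (!D.core k) k := by
    cases h : D.core k <;> simp [edge, D.apex_next, h]
  rw [← h3]
  simp only [edge, cond_false, cond_true]
  rw [mem_tri] at hx hy
  rcases hx with rfl | rfl | rfl <;> rcases hy with rfl | rfl | rfl <;>
    first | exact absurd rfl hxy | simp [Sym2.eq_swap]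

lemma Valid.next_ne (h : D.Valid) (k : W) : D.next k ≠ k := by
  have := h.not_isDiag false k
  simpa [edge] using this

lemma Valid.next_ne_apex (h : D.Valid) (k : W) : D.next k ≠ D.apex k := by
  have := h.not_isDiag true k
  simpa [edge] using this

lemma Valid.apex_ne (h : D.Valid) (k : W) : D.apex k ≠ k := by
  have := (h.edge_inj true k false k)
  simp [edge] at this
  exact this.1

lemma Valid.adj_of_mem_tri (h : D.Valid) {k x y : W} (hx : x ∈ D.tri k) (hy : y ∈ D.tri k)
    (hxy : x ≠ y) : D.graph.Adj x y := by
  obtain ⟨k, rfl⟩ := D.next_surjective k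
  rw [h.graph_adj]
  rcases edge_of_mem_tri hx hy hxy with h | h | h <;> exact ⟨_, _, h⟩

lemma Valid.tri_mem_cliqueSet (h : D.Valid) (k : W) : D.tri k ∈ D.graph.cliqueSet 3 := by
  classical
  rw [mem_cliqueSet_iff, is3Clique_iff]
  have h1 := h.next_ne k
  have h2 := h.next_ne_apex k
  have h3 := h.apex_ne k
  refine ⟨D.next k, k, D.apex k, h.adj_of_mem_tri (k := k) ?_ ?_ h1,
    h.adj_of_mem_tri (k := k) ?_ ?_ h2, h.adj_of_mem_tri (k := k) ?_ ?_ h3.symm, ?_⟩ <;>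
    simp [tri]

/-- Distinct triangles of a valid strip share an edge only if they are consecutive, and then they
share only the third edge of the second one. -/
lemma Valid.shared_edge (h : D.Valid) {k l x y : W} (hk : k ≠ l) (hx : x ∈ D.tri k)
    (hy : y ∈ D.tri k) (hx' : x ∈ D.tri l) (hy' : y ∈ D.tri l) (hxy : x ≠ y) :
    (l = D.next k ∧ s(x, y) = D.edge (!D.core k) k) ∨
      (k = D.next l ∧ s(x, y) = D.edge (!D.core l) l) := by
  obtain ⟨k, rfl⟩ := D.next_surjective k
  obtain ⟨l, rfl⟩ := D.next_surjective l
  rcases edge_of_mem_tri hx hy hxy with e | e | e <;>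
    rcases edge_of_mem_tri hx' hy' hxy with f | f | f <;>
    have := h.edge_inj _ _ _ _ (e.symm.trans f) <;> grind

lemma tri_inter_left (k : W) : D.next k ∈ D.tri k ∧ D.apex (D.next k) ∈ D.tri k := by
  cases h : D.core k <;> simp [tri, D.apex_next, h]

lemma tri_inter_right (k : W) : D.next k ∈ D.tri (D.next k) ∧ D.apex (D.next k) ∈ D.tri (D.next k) := by
  simp [tri]

/-- By `shared_edge`, equal triangles would be consecutive with a single common edge, while the two
edges at the new vertex are distinct. -/
lemma Valid.tri_injective (h : D.Valid) : Function.Injective D.tri := by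
  suffices H : ∀ k, D.tri k ≠ D.tri (D.next k) by
    intro k l hkl
    by_contra hne
    have hx : D.next k ∈ D.tri k := by simp [tri]
    have hy : k ∈ D.tri k := by simp [tri]
    rcases h.shared_edge hne hx hy (hkl ▸ hx) (hkl ▸ hy) (h.next_ne k) with ⟨rfl, -⟩ | ⟨rfl, -⟩
    · exact H _ hkl
    · exact H _ hkl.symm
  intro k hk
  have key : ∀ b, D.edge b k = D.edge (!D.core k) k := by
    intro b
    have h1 : D.next k ∈ D.tri k := by simp [tri]
    have h2 : (bif b then D.apex k else k) ∈ D.tri k := by cases b <;> simp [tri]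
    have h3 : D.next k ≠ (bif b then D.apex k else k) := by
      cases b
      · exact h.next_ne k
      · exact h.next_ne_apex k
    rcases h.shared_edge (h.next_ne k).symm h1 h2 (hk ▸ h1) (hk ▸ h2) h3 with ⟨-, e⟩ | ⟨e, e'⟩
    · exact e
    · have := h.edge_inj b k _ _ e'
      exact absurd this.2 (h.next_ne k).symm
  have := h.edge_inj _ _ _ _ ((key true).trans (key false).symm)
  simp at this

end Strip

/-- A transitive self-map of a finite type is the rotation of a cycle. -/
lemma exists_equiv_fin {W : Type*} [Fintype W] {n : ℕ} [NeZero n] (hn : Fintype.card W = n)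
    (σ : W → W) (hσ : ∀ s : Set W, s.Nonempty → (∀ k ∈ s, σ k ∈ s) → s = Set.univ) (w : W) :
    ∃ e : Fin n ≃ W, e 0 = w ∧ ∀ j, σ (e j) = e (j + 1) := by
  have hsurj : Function.Surjective σ := fun k =>
    (hσ (Set.range σ) ⟨σ k, k, rfl⟩ (fun a _ => ⟨a, rfl⟩)).symm.subset (Set.mem_univ k)
  have hinj : Function.Injective σ := Finite.injective_iff_surjective.2 hsurj
  have hper : w ∈ Function.periodicPts σ := hinj.mem_periodicPts w
  set N := Function.minimalPeriod σ w with hN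
  have hpos : 0 < N := Function.minimalPeriod_pos_of_mem_periodicPts hper
  have hit : σ^[N] w = w := Function.iterate_minimalPeriod
  have hmod : ∀ a, σ^[a % N] w = σ^[a] w := fun a => Function.iterate_mod_minimalPeriod_eq
  -- The orbit of `w` is invariant, hence everything, so the minimal period of `w` is the
  -- cardinality.
  have hbij : Function.Bijective (fun j : Fin N => σ^[j] w) := by
    constructor
    · intro a b hab
      exact Fin.ext (Function.iterate_injOn_Iio_minimalPeriod a.2 b.2 hab)
    · rw [← Set.range_eq_univ]
      refine hσ _ ⟨w, ⟨0, hpos⟩, rfl⟩ ?_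
      rintro _ ⟨j, rfl⟩
      by_cases hj : j.1 + 1 < N
      · exact ⟨⟨j.1 + 1, hj⟩, Function.iterate_succ_apply' _ _ _⟩
      · refine ⟨⟨0, hpos⟩, ?_⟩
        have : j.1 + 1 = N := by omega
        simp only [Function.iterate_zero, id]
        rw [← Function.iterate_succ_apply' σ, Nat.succ_eq_add_one, this, hit]
  have hNn : N = n := by
    rw [← hn, ← Fintype.card_of_bijective hbij, Fintype.card_fin]
  clear_value N
  subst hNn
  refine ⟨Equiv.ofBijective _ hbij, rfl, fun j => ?_⟩
  simp only [Equiv.ofBijective_apply]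
  rw [← Function.iterate_succ_apply' σ, Fin.val_add, hmod, Fin.val_one']
  rw [Function.iterate_add_apply, hmod, ← Function.iterate_add_apply]

/-! ### Deleting a non-core vertex -/

namespace Strip

variable {W : Type*} {D : Strip W}

open scoped Classical in
/-- Delete a vertex which is not a core vertex. -/
noncomputable def delete (D : Strip W) (i t : W) (hi : D.core i = false) (ht : D.core t = true) :
    Strip {a // a ≠ i} where
  next a := if h : D.next a = i then ⟨D.next i, next_ne_of_not_core ht hi⟩ else ⟨D.next a, h⟩
  core a := D.core a
  apex a := ⟨D.apex a, fun h => by simpa [h, hi] using core_apex ht a.1⟩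
  apex_next a := by
    by_cases h : D.next a = i
    · have h2 := D.apex_next a
      rw [h] at h2
      cases hc : D.core a <;> simp [h, apex_next_of_not_core hi, h2, hc]
    · cases hc : D.core a <;> simp [h, D.apex_next, hc]
  transitive s := by
    rintro ⟨⟨a, ha⟩, has⟩ hs
    -- The walk follows the old strip; at the deleted vertex `i` it records that `next i`, the
    -- vertex to which the new map jumps, lies in `s`.
    have key : ∀ k, (∃ h : k ≠ i, (⟨k, h⟩ : {a // a ≠ i}) ∈ s) ∨
        (k = i ∧ ∃ h : D.next i ≠ i, (⟨D.next i, h⟩ : {a // a ≠ i}) ∈ s) := by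
      intro k
      refine D.induction (P := fun k => (∃ h : k ≠ i, (⟨k, h⟩ : {a // a ≠ i}) ∈ s) ∨
        (k = i ∧ ∃ h : D.next i ≠ i, (⟨D.next i, h⟩ : {a // a ≠ i}) ∈ s)) a (Or.inl ⟨ha, has⟩) ?_ k
      rintro k (⟨h, hk⟩ | ⟨rfl, h⟩)
      · have := hs _ hk
        by_cases h' : D.next k = i
        · rw [dif_pos h'] at this
          exact Or.inr ⟨h', _, this⟩
        · rw [dif_neg h'] at this
          exact Or.inl ⟨h', this⟩
      · exact Or.inl h
    ext ⟨k, hk⟩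
    simp only [Set.mem_univ, iff_true]
    rcases key k with ⟨_, h⟩ | ⟨h, -⟩
    · exact h
    · exact absurd h hk

section delete

variable {i t : W} {hi : D.core i = false} {ht : D.core t = true}

lemma delete_next_of_eq {a : {a // a ≠ i}} (h : D.next a = i) :
    ((D.delete i t hi ht).next a : W) = D.next i := by
  simp [delete, h]

lemma delete_next_of_ne {a : {a // a ≠ i}} (h : D.next a ≠ i) :
    ((D.delete i t hi ht).next a : W) = D.next a := by
  simp [delete, h]

@[simp] lemma delete_apex (a : {a // a ≠ i}) : ((D.delete i t hi ht).apex a : W) = D.apex a := rfl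

@[simp] lemma delete_core (a : {a // a ≠ i}) : (D.delete i t hi ht).core a = D.core a := rfl

lemma edge_delete_of_ne [Finite W] {p : W} (hp : D.next p = i) {b : Bool} {a : {a // a ≠ i}} (ha : a.1 ≠ p) :
    ((D.delete i t hi ht).edge b a).map Subtype.val = D.edge b a := by
  have : D.next a ≠ i := fun h => ha (D.next_injective (h.trans hp.symm))
  cases b <;> simp [edge, delete_next_of_ne this]

lemma edge_delete_of_eq {p : W} (hp : D.next p = i) (hpi : p ≠ i) {b : Bool} :
    ((D.delete i t hi ht).edge b ⟨p, hpi⟩).map Subtype.val =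
      s(D.next i, bif b then D.apex p else p) := by
  cases b <;> simp [edge, delete_next_of_eq (a := ⟨p, hpi⟩) hp]

lemma apex_eq_of_next_eq {p : W} (hp : D.next p = i) :
    D.apex i = bif D.core p then p else D.apex p := by
  rw [← hp, D.apex_next]

/-- Deletion merges the triangles of `p` and `i` into {`next i`, `p`, `apex p`}. Of its two edges at
`next i`, the one ending in `apex i` already belonged to the strip. -/
lemma edge_true_eq {p : W} (hp : D.next p = i) (hpi : p ≠ i) :
    D.edge true i = ((D.delete i t hi ht).edge (!D.core p) ⟨p, hpi⟩).map Subtype.val := by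
  rw [edge_delete_of_eq hp hpi]
  cases h : D.core p <;> simp [edge, apex_eq_of_next_eq hp, h]

lemma pred_ne (hi : D.core i = false) (ht : D.core t = true) {p : W} (hp : D.next p = i) : p ≠ i := by
  rintro rfl
  exact next_ne_of_not_core ht hi hp

lemma apex_ne_deleted (hi : D.core i = false) (ht : D.core t = true) (k : W) : D.apex k ≠ i := by
  intro h
  simpa [h, hi] using core_apex ht k

/-- Every edge of a strip contains the deleted vertex or is an edge after the deletion. -/
lemma edge_cases [Finite W] {p : W} (hp : D.next p = i) (b : Bool) (k : W) :
    (k = p ∧ D.edge b k = s(i, bif b then D.apex p else p)) ∨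
    (k = i ∧ b = false ∧ D.edge b k = s(i, D.next i)) ∨
    ∃ c a, D.edge b k = ((D.delete i t hi ht).edge c a).map Subtype.val ∧
      ((b = true ∧ k = i ∧ c = (!D.core p) ∧ a.1 = p) ∨ (c = b ∧ a.1 = k ∧ k ≠ p ∧ k ≠ i)) := by
  have hpi := pred_ne hi ht hp
  by_cases hkp : k = p
  · subst hkp
    refine Or.inl ⟨rfl, ?_⟩
    cases b <;> simp [edge, hp]
  · by_cases hki : k = i
    · subst hki
      cases b
      · exact Or.inr (Or.inl ⟨rfl, rfl, by simp [edge, Sym2.eq_swap]⟩)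
      · exact Or.inr (Or.inr ⟨_, _, edge_true_eq hp hpi, Or.inl ⟨rfl, rfl, rfl, rfl⟩⟩)
    · exact Or.inr (Or.inr ⟨b, ⟨k, hki⟩, (edge_delete_of_ne (a := ⟨k, hki⟩) hp hkp).symm, Or.inr ⟨rfl, rfl, hkp, hki⟩⟩)

lemma deleted_not_mem_map (e : Sym2 {a // a ≠ i}) : i ∉ e.map Subtype.val := by
  simp [Sym2.mem_map]

/-- Reinserting a vertex that is not a core vertex preserves validity. -/
theorem valid_of_delete [Finite W] (h : (D.delete i t hi ht).Valid) : D.Valid := by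
  obtain ⟨p, hp⟩ := D.next_surjective i
  have hpi : p ≠ i := pred_ne hi ht hp
  have hsi : D.next i ≠ i := next_ne_of_not_core ht hi
  have hai := apex_ne_deleted hi ht (D := D)
  have hps : D.next i ≠ p := by
    have := h.next_ne ⟨p, hpi⟩
    rwa [Ne, Subtype.ext_iff, delete_next_of_eq (a := ⟨p, hpi⟩) hp] at this
  have has : D.next i ≠ D.apex p := by
    have := h.next_ne_apex ⟨p, hpi⟩
    rwa [Ne, Subtype.ext_iff, delete_next_of_eq (a := ⟨p, hpi⟩) hp] at this
  have hap : D.apex p ≠ p := by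
    have := h.apex_ne ⟨p, hpi⟩
    rwa [Ne, Subtype.ext_iff] at this
  have hinj : Function.Injective (Sym2.map (Subtype.val : {a // a ≠ i} → W)) :=
    Sym2.map.injective Subtype.val_injective
  -- Edges through `i` cannot collide with edges of the shorter strip, so beyond the hypothesis only
  -- the edges from `i` to `p`, `apex p` and `next i` need to be compared.
  have hcontra : ∀ (x : W) e, s(i, x) ≠ Sym2.map (Subtype.val : {a // a ≠ i} → W) e := by
    intro x e he
    exact deleted_not_mem_map e (he ▸ Sym2.mem_mk_left i x)
  constructor
  · intro b k
    rcases edge_cases (hi := hi) (ht := ht) hp b k with ⟨-, e⟩ | ⟨-, -, e⟩ | ⟨c, a, e, -⟩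
    · rw [e]
      cases b <;> simp [hpi.symm, (hai p).symm]
    · rw [e]; simp [hsi.symm]
    · rw [e, Sym2.isDiag_map Subtype.val_injective]
      exact h.not_isDiag c a
  · intro b k c l hkl
    rcases edge_cases (hi := hi) (ht := ht) hp b k with ⟨r, e⟩ | ⟨r, r', e⟩ | ⟨c', a, e, r⟩ <;>
      rcases edge_cases (hi := hi) (ht := ht) hp c l with ⟨q, f⟩ | ⟨q, q', f⟩ | ⟨d', a', f, q⟩ <;>
      rw [e, f] at hkl
    · rw [Sym2.congr_right] at hkl
      subst r q; cases b <;> cases c <;> simp [hap, hap.symm] at hkl ⊢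
    · rw [Sym2.congr_right] at hkl
      cases b <;> simp_all
    · exact absurd hkl (hcontra _ _)
    · rw [Sym2.congr_right] at hkl
      cases c <;> simp_all
    · simp_all
    · exact absurd hkl (hcontra _ _)
    · exact absurd hkl.symm (hcontra _ _)
    · exact absurd hkl.symm (hcontra _ _)
    · have := h.edge_inj _ _ _ _ (hinj hkl)
      obtain ⟨rfl, rfl⟩ := this
      grind

end delete
end Strip

/-! ### Reinsertion of a vertex as a weak edge splitting -/

section splitEdge

variable {V : Type*} (G : SimpleGraph V) (u v x : V)

lemma splitEdge_some_some {a b : V} :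
    (splitEdge G u v x).Adj (some a) (some b) ↔ G.Adj a b ∧ s(a, b) ≠ s(u, v) := by
  simp [splitEdge, map_adj']
  grind [SimpleGraph.adj_comm, SimpleGraph.Adj.ne]

lemma splitEdge_none_some {b : V} :
    (splitEdge G u v x).Adj none (some b) ↔ b = u ∨ b = v ∨ b = x := by
  simp [splitEdge, map_adj']

end splitEdge

namespace Strip

variable {W : Type*} {D : Strip W} {i t : W} {hi : D.core i = false} {ht : D.core t = true}

/-- The excluded edge is the one that the splitting removes: the edge of the merged triangle at
`next i` whose other end is not `apex i`. -/
lemma delete_graph_adj [Finite W] (h : (D.delete i t hi ht).Valid) {p : W} (hp : D.next p = i)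
    (hpi : p ≠ i) (a b : {a // a ≠ i}) :
    (D.delete i t hi ht).graph.Adj a b ∧
      s(a, b) ≠ (D.delete i t hi ht).edge (D.core p) ⟨p, hpi⟩ ↔ D.graph.Adj a b := by
  have hinj : Function.Injective (Sym2.map (Subtype.val : {a // a ≠ i} → W)) :=
    Sym2.map.injective Subtype.val_injective
  rw [h.graph_adj, (valid_of_delete h).graph_adj]
  constructor
  · rintro ⟨⟨c, k, hk⟩, hne⟩
    by_cases hkp : k = ⟨p, hpi⟩
    · subst hkp
      have hc : c = !D.core p := by
        cases c <;> cases hh : D.core p <;> simp_all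
      refine ⟨true, i, ?_⟩
      rw [edge_true_eq (hi := hi) (ht := ht) hp hpi, ← hc, ← hk]
      rfl
    · refine ⟨c, k, ?_⟩
      rw [← edge_delete_of_ne (hi := hi) (ht := ht) hp (fun h => hkp (Subtype.ext h)), ← hk]
      rfl
  · rintro ⟨c, k, hk⟩
    have hab : i ∉ s(a.1, b.1) := by
      have ha := a.2
      have hb := b.2
      simp [ha.symm, hb.symm]
    rw [hk] at hab
    rcases edge_cases (hi := hi) (ht := ht) hp c k with ⟨-, e⟩ | ⟨-, -, e⟩ | ⟨d, k', e, h'⟩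
    · simp [e] at hab
    · simp [e] at hab
    · have hk' : s(a, b) = (D.delete i t hi ht).edge d k' := hinj (hk.trans e)
      refine ⟨⟨d, k', hk'⟩, fun h2 => ?_⟩
      have := h.edge_inj _ _ _ _ (hk'.symm.trans h2)
      obtain ⟨rfl, rfl⟩ := this
      rcases h' with ⟨-, -, h', -⟩ | ⟨-, h', h'', -⟩
      · cases hh : D.core p <;> simp [hh] at h'
      · exact h'' h'.symm

lemma graph_adj_deleted [Finite W] (h : (D.delete i t hi ht).Valid) {p : W} (hp : D.next p = i)
    (b : W) : D.graph.Adj i b ↔ b = p ∨ b = D.apex p ∨ b = D.next i := by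
  rw [(valid_of_delete h).graph_adj]
  constructor
  · rintro ⟨c, k, hk⟩
    rcases edge_cases (hi := hi) (ht := ht) hp c k with ⟨-, e⟩ | ⟨-, -, e⟩ | ⟨d, k', e, h'⟩
    · rw [e, Sym2.congr_right] at hk
      cases c <;> simp [hk]
    · rw [e, Sym2.congr_right] at hk
      simp [hk]
    · exact absurd (hk.trans e ▸ Sym2.mem_mk_left i b) (deleted_not_mem_map _)
  · rintro (rfl | rfl | rfl)
    · exact ⟨false, b, by simp [edge, hp]⟩
    · exact ⟨true, p, by simp [edge, hp]⟩
    · exact ⟨false, i, by simp [edge, Sym2.eq_swap]⟩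

open scoped Classical in
lemma tri_delete_of_ne [Finite W] {p : W} (hp : D.next p = i) {a : {a // a ≠ i}} (ha : a.1 ≠ p) :
    ((D.delete i t hi ht).tri a).map (Function.Embedding.subtype _) = D.tri a := by
  have : D.next a ≠ i := fun h => ha (D.next_injective (h.trans hp.symm))
  simp [tri, Finset.map_insert, delete_next_of_ne this]

/-- Reinserting a vertex that is not a core vertex is a weak edge splitting. -/
theorem isWeakEdgeSplitting_delete [Finite W] (h : (D.delete i t hi ht).Valid) :
    IsWeakEdgeSplitting (D.delete i t hi ht).graph (Set.range (D.delete i t hi ht).tri)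
      D.graph (Set.range D.tri) := by
  classical
  obtain ⟨p, hp⟩ := D.next_surjective i
  have hpi : p ≠ i := pred_ne hi ht hp
  set D' := D.delete i t hi ht with hD'
  set P : {a // a ≠ i} := ⟨p, hpi⟩
  have hs : (D'.next P : W) = D.next i := delete_next_of_eq hp
  -- the endpoints of the split edge and the third vertex
  obtain ⟨u, x, huv, hx, hux, hia, hpu⟩ : ∃ u x : {a // a ≠ i}, s(u, D'.next P) = D'.edge (D.core p) P ∧
      ({u, D'.next P, x} : Finset _) = D'.tri P ∧
      (∀ b : W, D.graph.Adj i b ↔ b = u ∨ b = D'.next P ∨ b = x) ∧ D.apex i = x ∧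
      D.tri p = {(u : W), i, (x : W)} := by
    cases hc : D.core p
    · refine ⟨P, D'.apex P, by simp [edge, Sym2.eq_swap], ?_, fun b => ?_, ?_, ?_⟩
      · ext; simp [tri]; tauto
      · rw [graph_adj_deleted h hp, hs]
        simp only [P, D', delete_apex]; tauto
      · rw [apex_eq_of_next_eq hp, hc]; rfl
      · ext; simp only [mem_tri, hp, P, D', delete_apex, Finset.mem_insert, Finset.mem_singleton]
        tauto
    · refine ⟨D'.apex P, P, by simp [edge, Sym2.eq_swap], ?_, fun b => ?_, ?_, ?_⟩
      · ext; simp [tri]; tauto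
      · rw [graph_adj_deleted h hp, hs]
        simp only [P, D', delete_apex]; tauto
      · rw [apex_eq_of_next_eq hp, hc]; rfl
      · ext; simp only [mem_tri, hp, P, D', delete_apex, Finset.mem_insert, Finset.mem_singleton]
        tauto
  refine ⟨u, D'.next P, x, ?_, ⟨P, by convert hx.symm⟩, ?_, ?_⟩
  · rw [h.graph_adj]; exact ⟨_, _, huv⟩
  · rintro _ ⟨l, rfl⟩ hul hvl
    have hne : u ≠ D'.next P := by
      intro hne
      exact h.not_isDiag (D.core p) P (huv ▸ hne)
    obtain ⟨l, rfl⟩ := D'.next_surjective l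
    -- By validity the edge `uv` has only one label. The label of the edge passed on to the next
    -- triangle carries the opposite Boolean, so no other triangle contains `uv`.
    rcases edge_of_mem_tri hul hvl hne with e | e | e
    · rw [← (h.edge_inj _ _ _ _ (huv.symm.trans e)).2, ← hx]
      congr!
    · rw [← (h.edge_inj _ _ _ _ (huv.symm.trans e)).2, ← hx]
      congr!
    · obtain ⟨h1, rfl⟩ := h.edge_inj _ _ _ _ (huv.symm.trans e)
      simp [D', P] at h1
  · refine ⟨⟨Equiv.optionSubtypeNe i, ?_⟩, ?_⟩
    · intro a b
      rcases a with _ | a <;> rcases b with _ | b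
      · simp
      · simp only [Equiv.optionSubtypeNe_none, Equiv.optionSubtypeNe_some, hux,
          splitEdge_none_some, Subtype.ext_iff]
      · rw [D.graph.adj_comm, (splitEdge _ _ _ _).adj_comm]
        simp only [Equiv.optionSubtypeNe_none, Equiv.optionSubtypeNe_some, hux,
          splitEdge_none_some, Subtype.ext_iff]
      · simp only [Equiv.optionSubtypeNe_some]
        rw [← delete_graph_adj h hp hpi, ← huv, splitEdge_some_some]
    · have hp' : D.tri p = Finset.map (Equiv.optionSubtypeNe i).toEmbedding
          {some u, none, some x} := by
        rw [hpu]; simp [Finset.map_insert]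
      have hi' : D.tri i = Finset.map (Equiv.optionSubtypeNe i).toEmbedding
          {none, some (D'.next P), some x} := by
        ext; simp [mem_tri, hs, hia]; tauto
      have ha' : ∀ a : {a // a ≠ i}, a.1 ≠ p → D.tri a = Finset.map
          (Equiv.optionSubtypeNe i).toEmbedding ((D'.tri a).map Function.Embedding.some) := by
        intro a ha
        rw [← tri_delete_of_ne (hi := hi) (ht := ht) hp ha, Finset.map_map]
        congr 1
      ext T
      constructor
      · rintro ⟨k, rfl⟩
        by_cases hki : k = i
        · subst hki
          exact ⟨_, Or.inr (Or.inr rfl), by rw [hi']; congr!⟩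
        · by_cases hkp : k = p
          · subst hkp
            exact ⟨_, Or.inr (Or.inl rfl), by rw [hp']; congr!⟩
          · refine ⟨_, Or.inl ⟨D'.tri ⟨k, hki⟩, ⟨⟨_, rfl⟩, ?_⟩, rfl⟩, ?_⟩
            · rw [Set.mem_singleton_iff]
              intro he
              refine hkp (congrArg Subtype.val (h.tri_injective (a₁ := ⟨k, hki⟩) (a₂ := P) ?_))
              rw [← hx, he]; congr!
            · rw [ha' ⟨k, hki⟩ hkp]
      · rintro ⟨_, (⟨_, ⟨⟨a, rfl⟩, hne⟩, rfl⟩ | (rfl | rfl)), rfl⟩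
        · refine ⟨a, ?_⟩
          refine ha' a fun hap => hne ?_
          have : a = P := Subtype.ext hap
          rw [this, ← hx, Set.mem_singleton_iff]; congr!
        · exact ⟨p, by rw [hp']; congr!⟩
        · exact ⟨i, by rw [hi']; congr!⟩

end Strip

/-! ### Induced cycles of the triangle graph as numbered sequences -/

/-- Two vertex sets share an edge, i.e. two distinct vertices. -/
def Shares {V : Type*} (s t : Finset V) : Prop :=
  ∃ a b : V, a ≠ b ∧ a ∈ s ∧ b ∈ s ∧ a ∈ t ∧ b ∈ t

lemma Shares.symm {V : Type*} {s t : Finset V} (h : Shares s t) : Shares t s := by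
  obtain ⟨a, b, hab, h1, h2, h3, h4⟩ := h
  exact ⟨a, b, hab, h3, h4, h1, h2⟩

lemma triangleGraph_adj {V : Type*} {G : SimpleGraph V} {s t : G.cliqueSet 3} :
    (triangleGraph G).Adj s t ↔ s ≠ t ∧ Shares (s : Finset V) t := Iff.rfl

/-- A cyclic sequence of triangles that is an induced cycle of the triangle graph. -/
structure IsTriCycle {V : Type*} {n : ℕ} (G : SimpleGraph V) (c : Fin n → Finset V) : Prop where
  injective : Function.Injective c
  mem : ∀ i, c i ∈ G.cliqueSet 3
  shares_iff : ∀ i j, i ≠ j → (Shares (c i) (c j) ↔ (cycleGraph n).Adj i j)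

/-- Sets of triangles are traded for numbered cycles, on which index arithmetic is possible. -/
lemma isInducedTriangleCycle_iff {V : Type*} {n : ℕ} {G : SimpleGraph V} {S : Set (Finset V)} :
    IsInducedTriangleCycle n G S ↔ ∃ c : Fin n → Finset V, IsTriCycle G c ∧ Set.range c = S := by
  constructor
  · rintro ⟨hS, ⟨f⟩⟩
    refine ⟨fun i => ((f i).1.1 : Finset V), ⟨?_, fun i => (f i).1.2, ?_⟩, ?_⟩
    · intro i j hij
      exact f.injective (Subtype.ext (Subtype.ext hij))
    · intro i j hij
      rw [← f.map_adj_iff]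
      simp only [comap_adj, Function.Embedding.subtype_apply, triangleGraph_adj]
      rw [and_iff_right]
      intro h
      exact hij (f.injective (Subtype.ext h))
    · ext t
      constructor
      · rintro ⟨i, rfl⟩
        exact (f i).2
      · intro ht
        refine ⟨f.symm ⟨⟨t, hS ht⟩, ht⟩, ?_⟩
        simp
  · rintro ⟨c, hc, rfl⟩
    refine ⟨by rintro _ ⟨i, rfl⟩; exact hc.mem i, ⟨⟨Equiv.ofBijective
      (fun i => ⟨⟨c i, hc.mem i⟩, i, rfl⟩) ⟨?_, ?_⟩, ?_⟩⟩⟩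
    · intro i j hij
      exact hc.injective (congrArg (fun t => t.1.1) hij)
    · rintro ⟨⟨t, ht⟩, i, hi⟩
      exact ⟨i, Subtype.ext (Subtype.ext hi)⟩
    · intro i j
      by_cases hij : i = j
      · subst hij; simp
      · refine Iff.trans ?_ (hc.shares_iff i j hij)
        exact and_iff_right fun h => hij (hc.injective (congrArg Subtype.val h))

lemma isIndContained_triangleGraph_iff {V : Type*} {n : ℕ} {G : SimpleGraph V} :
    (cycleGraph n).IsIndContained (triangleGraph G) ↔ ∃ c : Fin n → Finset V, IsTriCycle G c := by
  constructor
  · rintro ⟨f⟩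
    refine ⟨fun i => ((f i).1 : Finset V), ⟨?_, fun i => (f i).2, ?_⟩⟩
    · intro i j hij
      exact f.injective (Subtype.ext hij)
    · intro i j hij
      rw [← f.map_adj_iff, triangleGraph_adj, and_iff_right]
      intro h
      exact hij (f.injective h)
  · rintro ⟨c, hc⟩
    refine ⟨⟨⟨fun i => ⟨c i, hc.mem i⟩, ?_⟩, ?_⟩⟩
    · intro i j hij
      exact hc.injective (congrArg Subtype.val hij)
    · intro i j
      by_cases hij : i = j
      · subst hij; simp
      · refine Iff.trans ?_ (hc.shares_iff i j hij)
        exact and_iff_right fun h => hij (hc.injective (congrArg Subtype.val h))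

lemma IsInducedTriangleCycle.isIndContained {V : Type*} {n : ℕ} {G : SimpleGraph V}
    {S : Set (Finset V)} (h : IsInducedTriangleCycle n G S) :
    (cycleGraph n).IsIndContained (triangleGraph G) := by
  rw [isInducedTriangleCycle_iff] at h
  rw [isIndContained_triangleGraph_iff]
  exact ⟨_, h.choose_spec.1⟩

lemma cycleGraph_adj_iff {n : ℕ} [NeZero n] (hn : 2 ≤ n) {i j : Fin n} :
    (cycleGraph n).Adj i j ↔ j = i + 1 ∨ i = j + 1 := by
  obtain ⟨n, rfl⟩ := Nat.exists_eq_add_of_le' hn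
  rw [cycleGraph_adj, sub_eq_iff_eq_add', sub_eq_iff_eq_add', or_comm]

namespace Strip

variable {W : Type*} {D : Strip W}

lemma Valid.shares_iff (h : D.Valid) {k l : W} (hkl : k ≠ l) :
    Shares (D.tri k) (D.tri l) ↔ l = D.next k ∨ k = D.next l := by
  constructor
  · rintro ⟨x, y, hxy, h1, h2, h3, h4⟩
    rcases h.shared_edge hkl h1 h2 h3 h4 hxy with h | h
    · exact Or.inl h.1
    · exact Or.inr h.1
  · have key : ∀ k, Shares (D.tri k) (D.tri (D.next k)) := by
      intro k
      refine ⟨D.next k, D.apex (D.next k), (h.apex_ne _).symm, (tri_inter_left k).1,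
        (tri_inter_left k).2, (tri_inter_right k).1, (tri_inter_right k).2⟩
    rintro (rfl | rfl)
    · exact key k
    · exact (key l).symm

theorem Valid.isInducedTriangleCycle [Finite W] (h : D.Valid) :
    IsInducedTriangleCycle (Nat.card W) D.graph (Set.range D.tri) := by
  rcases isEmpty_or_nonempty W with hW | ⟨⟨w⟩⟩
  · rw [Nat.card_of_isEmpty, isInducedTriangleCycle_iff]
    exact ⟨Fin.elim0, ⟨fun i => i.elim0, fun i => i.elim0, fun i => i.elim0⟩, by simp [Set.range_eq_empty]⟩
  have := Fintype.ofFinite W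
  have hn : 2 ≤ Nat.card W := by
    rw [Nat.card_eq_fintype_card]
    exact Fintype.one_lt_card_iff.2 ⟨_, _, h.next_ne w⟩
  have : NeZero (Nat.card W) := ⟨by omega⟩
  obtain ⟨e, -, he⟩ := exists_equiv_fin (Nat.card_eq_fintype_card (α := W)).symm D.next
    D.transitive w
  rw [isInducedTriangleCycle_iff]
  refine ⟨fun i => D.tri (e i), ⟨h.tri_injective.comp e.injective,
    fun i => h.tri_mem_cliqueSet _, fun i j hij => ?_⟩, ?_⟩
  · rw [h.shares_iff (e.injective.ne hij), cycleGraph_adj_iff hn, he, he, e.injective.eq_iff,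
      e.injective.eq_iff]
  · rw [← e.surjective.range_comp D.tri]; rfl

/-! ### Strips given by tables, and adjacency in the named graphs -/

/-- The edges of a strip on `Fin n` with successor `· + 1` and apices `a`. -/
def tableEdge {n : ℕ} [NeZero n] (a : Fin n → Fin n) (b : Bool) (k : Fin n) : Sym2 (Fin n) :=
  s(k + 1, bif b then a k else k)

variable {n : ℕ} [NeZero n] {e : Fin n ≃ W} {a : Fin n → Fin n}

lemma edge_eq_map_tableEdge (he : ∀ j, D.next (e j) = e (j + 1)) (ha : ∀ j, D.apex (e j) = e (a j))
    (b : Bool) (k : Fin n) : D.edge b (e k) = (tableEdge a b k).map e := by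
  cases b <;> simp [edge, tableEdge, he, ha]

/-- Moves validity to `Fin n`, where for a concrete table `decide` settles it. -/
lemma valid_of_table (he : ∀ j, D.next (e j) = e (j + 1)) (ha : ∀ j, D.apex (e j) = e (a j))
    (h1 : ∀ b k, ¬ (tableEdge a b k).IsDiag)
    (h2 : ∀ b k c l, tableEdge a b k = tableEdge a c l → b = c ∧ k = l) : D.Valid := by
  constructor
  · intro b k
    obtain ⟨k, rfl⟩ := e.surjective k
    rw [edge_eq_map_tableEdge he ha, Sym2.isDiag_map e.injective]
    exact h1 b k
  · intro b k c l h
    obtain ⟨k, rfl⟩ := e.surjective k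
    obtain ⟨l, rfl⟩ := e.surjective l
    rw [edge_eq_map_tableEdge he ha, edge_eq_map_tableEdge he ha] at h
    have := h2 _ _ _ _ (Sym2.map.injective e.injective h)
    exact ⟨this.1, congrArg e this.2⟩

lemma nonempty_iso_of_table (he : ∀ j, D.next (e j) = e (j + 1))
    (ha : ∀ j, D.apex (e j) = e (a j)) {H : SimpleGraph (Fin n)} (π : Fin n ≃ Fin n)
    (hH : ∀ i j, (i ≠ j ∧ ∃ b k, s(i, j) = tableEdge a b k) ↔ H.Adj (π i) (π j)) :
    Nonempty (H ≃g D.graph) := by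
  refine ⟨(⟨e.symm.trans π, fun {x y} => ?_⟩ : D.graph ≃g H).symm⟩
  obtain ⟨x, rfl⟩ := e.surjective x
  obtain ⟨y, rfl⟩ := e.surjective y
  simp only [Equiv.trans_apply, Equiv.symm_apply_apply]
  rw [← hH, Strip.graph_adj, and_comm, e.injective.ne_iff, and_congr_left_iff]
  intro _
  constructor
  · rintro ⟨b, k, h⟩
    exact ⟨b, e k, by rw [edge_eq_map_tableEdge he ha, ← h]; rfl⟩
  · rintro ⟨b, k, h⟩
    obtain ⟨k, rfl⟩ := e.surjective k
    rw [edge_eq_map_tableEdge he ha] at h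
    exact ⟨b, k, Sym2.map.injective e.injective h⟩

end Strip

lemma power_two_adj {V : Type*} {G : SimpleGraph V} {u v : V} :
    (power G 2).Adj u v ↔ u ≠ v ∧ (G.Adj u v ∨ ∃ w, G.Adj u w ∧ G.Adj w v) := by
  refine and_congr_right fun huv => ?_
  constructor
  · intro h
    obtain ⟨p, hp⟩ := exists_walk_of_edist_ne_top (ne_top_of_le_ne_top (by simp) h)
    rw [← hp] at h
    have h : p.length ≤ 2 := by exact_mod_cast h
    cases p with
    | nil => exact absurd rfl huv
    | cons h1 p =>
      cases p with
      | nil => exact Or.inl h1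
      | cons h2 p =>
        cases p with
        | nil => exact Or.inr ⟨_, h1, h2⟩
        | cons h3 p => simp at h
  · rintro (h | ⟨w, h1, h2⟩)
    · exact (Walk.edist_le (.cons h .nil)).trans (by simp)
    · exact (Walk.edist_le (.cons h1 (.cons h2 .nil))).trans (by simp)

lemma cycleSquare_adj {n : ℕ} [NeZero n] (hn : 2 ≤ n) {i j : Fin n} :
    (cycleSquare n).Adj i j ↔ i ≠ j ∧ (j = i + 1 ∨ i = j + 1 ∨ j = i + 1 + 1 ∨ i = j + 1 + 1) := by
  rw [cycleSquare, power_two_adj]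
  simp only [cycleGraph_adj_iff hn]
  constructor
  · rintro ⟨hne, (h | h) | ⟨w, h1 | h1, h2 | h2⟩⟩
    · exact ⟨hne, by tauto⟩
    · exact ⟨hne, by tauto⟩
    · subst h1 h2; simp [hne]
    · rw [h1] at h2; exact absurd (add_right_cancel h2) hne
    · exact absurd (h1.trans h2.symm) hne
    · subst h1 h2; simp [hne]
  · rintro ⟨hne, h | h | h | h⟩
    · exact ⟨hne, by tauto⟩
    · exact ⟨hne, by tauto⟩
    · exact ⟨hne, Or.inr ⟨i + 1, by simp [h]⟩⟩
    · exact ⟨hne, Or.inr ⟨j + 1, by simp [h]⟩⟩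

lemma K6MinusK3_adj {a b : Fin 6} : K6MinusK3.Adj a b ↔ a ≠ b ∧ ¬ (a.1 < 3 ∧ b.1 < 3) := by
  rw [K6MinusK3, completeMinus, sdiff_adj, top_adj, map_adj']
  revert a b
  decide

lemma K6MinusP4_adj {a b : Fin 6} : K6MinusP4.Adj a b ↔
    a ≠ b ∧ ¬ (a.1 + 1 = b.1 ∧ b.1 < 4 ∨ b.1 + 1 = a.1 ∧ a.1 < 4) := by
  rw [K6MinusP4, completeMinus, sdiff_adj, top_adj, map_adj']
  simp only [pathGraph_adj]
  revert a b
  decide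

namespace Strip

variable {W : Type*} {D : Strip W}

lemma exists_equiv_fin_card [Finite W] {n : ℕ} [NeZero n] (hn : Nat.card W = n) (w : W) :
    ∃ e : Fin n ≃ W, e 0 = w ∧ ∀ j, D.next (e j) = e (j + 1) := by
  have := Fintype.ofFinite W
  rw [Nat.card_eq_fintype_card] at hn
  exact exists_equiv_fin hn D.next D.transitive w

lemma iterate_next_ne [Finite W] (D : Strip W) {j : ℕ} (hj : 0 < j) (hj' : j < Nat.card W) (k : W) :
    D.next^[j] k ≠ k := by
  have : NeZero (Nat.card W) := ⟨by omega⟩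
  obtain ⟨e, he0, he⟩ := D.exists_equiv_fin_card rfl k
  have h : ∀ j : ℕ, D.next^[j] k = e (Fin.ofNat _ j) := by
    intro j
    induction j with
    | zero => simp [← he0]
    | succ j ih => rw [Function.iterate_succ_apply', ih, he]; congr 1; ext; simp [Fin.val_add]
  intro heq
  rw [h, ← he0, e.injective.eq_iff, Fin.ext_iff] at heq
  simp [Nat.mod_eq_of_lt hj'] at heq
  omega

/-! ### Reduction of strips to the base graphs -/

/-- A strip all of whose vertices are core vertices is valid. -/
lemma valid_of_forall_core [Finite W] (hcard : 5 ≤ Nat.card W) (hT : ∀ k, D.core k = true) :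
    D.Valid := by
  -- Edges join vertices one or two steps apart, so a coincidence of two edges would need a return
  -- after at most four steps.
  have h1 := fun k => D.iterate_next_ne (j := 1) (by omega) (by omega) k
  have h2 := fun k => D.iterate_next_ne (j := 2) (by omega) (by omega) k
  have h3 := fun k => D.iterate_next_ne (j := 3) (by omega) (by omega) k
  have h4 := fun k => D.iterate_next_ne (j := 4) (by omega) (by omega) k
  simp only [Function.iterate_succ_apply, Function.iterate_zero_apply] at h1 h2 h3 h4
  have ha := fun k => apex_next_of_core (hT k)
  have hinj := D.next_injective
  constructor
  · intro b k
    obtain ⟨k, rfl⟩ := D.next_surjective k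
    cases b <;> simp [edge, ha, h1, h2]
  · intro b k c l h
    obtain ⟨k, rfl⟩ := D.next_surjective k
    obtain ⟨l, rfl⟩ := D.next_surjective l
    cases b <;> cases c <;> simp only [edge, ha, cond_false, cond_true, Sym2.eq_iff] at h <;> grind

lemma core_card_delete [Finite W] {i t : W} {hi : D.core i = false} {ht : D.core t = true} :
    Nat.card {a // (D.delete i t hi ht).core a = true} = Nat.card {a // D.core a = true} := by
  refine Nat.card_congr ⟨fun a => ⟨a.1, a.2⟩, fun a => ⟨⟨a, ?_⟩, a.2⟩, fun _ => rfl, fun _ => rfl⟩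
  rintro rfl
  simpa [hi] using a.2

lemma card_delete [Finite W] {i : W} : Nat.card {a // a ≠ i} + 1 = Nat.card W := by
  classical
  rw [← Finite.card_option]
  exact Nat.card_congr (Equiv.optionSubtypeNe i)

lemma card_core_add [Finite W] (D : Strip W) :
    Nat.card {a // D.core a = true} + Nat.card {a // D.core a = false} = Nat.card W := by
  have := Fintype.ofFinite W
  simp only [Nat.card_eq_fintype_card]
  have := Fintype.card_subtype_compl (fun a => D.core a = true)
  have h2 := Fintype.card_subtype_le (fun a => D.core a = true)
  simp only [Bool.not_eq_true] at this
  omega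

lemma exists_core {m : ℕ} (hm : Nat.card {a // D.core a = true} = m) (h : 0 < m) :
    ∃ t, D.core t = true := by
  have : 0 < Nat.card {a // D.core a = true} := by omega
  obtain ⟨⟨t⟩, -⟩ := Nat.card_pos_iff.1 this
  exact ⟨t, t.2⟩

/-- If every strip with the property `P` either has `m` vertices and is isomorphic to `B`, or can
be reduced by the deletion of a vertex to a strip with the property `P`, then all the strips with
the property `P` arise from `B` by weak edge splittings. -/
theorem obtainedBySplittings_of_reduces {V : Type} {B : SimpleGraph V} {m : ℕ}
    (P : ∀ {W : Type}, Strip W → Prop)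
    (hP : ∀ (W : Type) [Finite W] (D : Strip W), P D →
      (Nat.card W = m ∧ D.Valid ∧ Nonempty (B ≃g D.graph)) ∨
      ∃ i t hi ht, P (D.delete i t hi ht)) (W : Type) [Finite W] (D : Strip W) (hD : P D) :
    D.Valid ∧ m ≤ Nat.card W ∧
      ObtainedBySplittings m B (Nat.card W - m) D.graph (Set.range D.tri) := by
  induction hn : Nat.card W using Nat.strong_induction_on generalizing W with
  | _ n ih =>
    rcases hP W D hD with ⟨rfl, hv, hB⟩ | ⟨i, t, hi, ht, hd⟩
    · refine ⟨hv, hn.le, ?_⟩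
      rw [← hn, Nat.sub_self]
      exact .start hB hv.isInducedTriangleCycle
    · have hc := card_delete (W := W) (i := i)
      obtain ⟨h1, h2, h3⟩ := ih _ (by omega) _ _ hd rfl
      refine ⟨valid_of_delete h1, by omega, ?_⟩
      have : n - m = Nat.card {a // a ≠ i} - m + 1 := by omega
      rw [this]
      exact .step h3 (isWeakEdgeSplitting_delete h1)

end Strip
namespace Strip

/-- Every non-core vertex may be deleted. What remains consists of core vertices only, `apex` is the
predecessor, and the edges join vertices one or two steps apart. -/
theorem obtained_of_five_le {m : ℕ} (hm : 5 ≤ m) (W : Type) [Finite W] (D : Strip W)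
    (hD : Nat.card {a // D.core a = true} = m) :
    D.Valid ∧ m ≤ Nat.card W ∧
      ObtainedBySplittings m (cycleSquare m) (Nat.card W - m) D.graph (Set.range D.tri) := by
  refine obtainedBySplittings_of_reduces
    (fun {W} D => Nat.card {a // D.core a = true} = m) ?_ W D hD
  clear hD D
  clear! W
  intro W _ D hD
  have hsum := D.card_core_add
  obtain ⟨t, ht⟩ := exists_core hD (by omega)
  by_cases hF : ∃ i, D.core i = false
  · obtain ⟨i, hi⟩ := hF
    exact Or.inr ⟨i, t, hi, ht, core_card_delete.trans hD⟩
  · have hT : ∀ k, D.core k = true := by simpa using hF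
    left
    have hW : Nat.card W = m := by
      have : IsEmpty {a // D.core a = false} := ⟨fun a => hF ⟨a, a.2⟩⟩
      rw [← hsum, hD, Nat.card_of_isEmpty, add_zero]
    refine ⟨hW, valid_of_forall_core (by omega) hT, ?_⟩
    have : NeZero m := ⟨by omega⟩
    obtain ⟨e, -, he⟩ := D.exists_equiv_fin_card hW t
    have ha : ∀ j, D.apex (e j) = e (j - 1) := by
      intro j
      have := he (j - 1)
      rw [sub_add_cancel] at this
      rw [← this, apex_next_of_core (hT _)]
    refine nonempty_iso_of_table (a := fun j => j - 1) he ha (Equiv.refl _) fun i j => ?_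
    simp only [Equiv.refl_apply]
    rw [cycleSquare_adj (by omega)]
    refine and_congr_right fun _ => ?_
    constructor
    · rintro ⟨b, k, h⟩
      cases b <;> simp only [tableEdge, cond_false, cond_true, Sym2.eq_iff] at h
      · rcases h with ⟨rfl, rfl⟩ | ⟨rfl, rfl⟩ <;> simp
      · rcases h with ⟨rfl, rfl⟩ | ⟨rfl, rfl⟩ <;> simp
    · rintro (h | h | h | h)
      · exact ⟨false, i, by simp [tableEdge, h, Sym2.eq_swap]⟩
      · exact ⟨false, j, by simp [tableEdge, h]⟩
      · exact ⟨true, i + 1, by simp [tableEdge, h, Sym2.eq_swap]⟩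
      · exact ⟨true, j + 1, by simp [tableEdge, h]⟩

lemma next_delete_eq {W : Type*} {D : Strip W} {i t : W} {hi : D.core i = false} {ht : D.core t = true}
    (a : {a // a ≠ i}) : ((D.delete i t hi ht).next a : W) = D.next a ∨
      D.next a = i ∧ ((D.delete i t hi ht).next a : W) = D.next i := by
  by_cases h : D.next a = i
  · exact Or.inr ⟨h, delete_next_of_eq h⟩
  · exact Or.inl (delete_next_of_ne h)

section base

variable {W : Type} [Finite W] {D : Strip W}

/-- The word alternates; the pairs missing from `K_6` are those among the non-core positions 0, 2,
4. -/
lemma base_K6MinusK3 (hW : Nat.card W = 6) {w : W} (hw : D.core w = false)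
    (h : ∀ a, D.core (D.next a) = !D.core a) :
    D.Valid ∧ Nonempty (K6MinusK3 ≃g D.graph) := by
  obtain ⟨e, rfl, he⟩ := D.exists_equiv_fin_card hW w
  have hc : ∀ j, D.core (e (j + 1)) = !D.core (e j) := fun j => by rw [← he, h]
  have ha : ∀ j, D.apex (e (j + 1)) = bif D.core (e j) then e j else D.apex (e j) :=
    fun j => by rw [← he, apex_next]
  have c1 := hc 0; have c2 := hc 1; have c3 := hc 2; have c4 := hc 3; have c5 := hc 4
  have a1 := ha 0; have a2 := ha 1; have a3 := ha 2; have a4 := ha 3; have a5 := ha 4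
  have a0 := ha 5
  simp only [Fin.isValue, Fin.reduceAdd, hw, Bool.not_false] at c1 a1
  simp only [Fin.isValue, Fin.reduceAdd, c1, Bool.not_true, cond_true] at c2 a2
  simp only [Fin.isValue, Fin.reduceAdd, c2, Bool.not_false, cond_false, a2] at c3 a3
  simp only [Fin.isValue, Fin.reduceAdd, c3, Bool.not_true, cond_true] at c4 a4
  simp only [Fin.isValue, Fin.reduceAdd, c4, Bool.not_false, cond_false, a4] at c5 a5
  simp only [Fin.isValue, Fin.reduceAdd, c5, cond_true] at a0
  simp only [Fin.isValue, cond_false, a0] at a1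
  have hA : ∀ j, D.apex (e j) = e ((![5, 5, 1, 1, 3, 3] : Fin 6 → Fin 6) j) := by
    intro j; fin_cases j <;> assumption
  refine ⟨valid_of_table he hA (by decide) (by decide), ?_⟩
  refine nonempty_iso_of_table he hA
    ⟨![0, 3, 1, 4, 2, 5], ![0, 2, 4, 1, 3, 5], by decide, by decide⟩ ?_
  simp only [K6MinusK3_adj]
  decide

/-- With `y` at position 0, `hap` leaves only position 4 for `x`. The pairs missing from `K_6` then
form the path 2, 0, 4, 1. -/
lemma base_K6MinusP4 (hW : Nat.card W = 6) {x y : W} (hx : D.core x = false)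
    (hy : D.core y = false) (hxy : x ≠ y) (h : ∀ a, D.core a = false → a = x ∨ a = y)
    (hap : D.apex x = D.apex (D.apex y)) :
    D.Valid ∧ Nonempty (K6MinusP4 ≃g D.graph) := by
  obtain ⟨e, rfl, he⟩ := D.exists_equiv_fin_card hW y
  obtain ⟨j, rfl⟩ := e.surjective x
  have hc : ∀ i, i ≠ j → i ≠ 0 → D.core (e i) = true := by
    intro i h1 h2
    by_contra h3
    rcases h (e i) (by simpa using h3) with h3 | h3
    · exact h1 (e.injective h3)
    · exact h2 (e.injective h3)
  have ha : ∀ j, D.apex (e (j + 1)) = bif D.core (e j) then e j else D.apex (e j) :=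
    fun j => by rw [← he, apex_next]
  have A : ∀ i, D.core (e i) = true → D.apex (e (i + 1)) = e i := fun i hi => by rw [ha, hi]; rfl
  have A0 : D.apex (e (0 + 1)) = D.apex (e 0) := by rw [ha, hy]; rfl
  have Aj : D.apex (e (j + 1)) = D.apex (e j) := by rw [ha, hx]; rfl
  have hj : j = 4 := by
    by_contra hj4
    have A5 : j ≠ 5 → D.apex (e 0) = e 5 ∧ D.apex (e 5) = e 4 := fun h =>
      ⟨A 5 (hc 5 h.symm (by decide)), A 4 (hc 4 (Ne.symm hj4) (by decide))⟩
    suffices ∃ a b, a ≠ b ∧ e a = e b by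
      obtain ⟨a, b, hab, h⟩ := this
      exact hab (e.injective h)
    by_cases h5 : j = 5
    · subst h5
      have e5 : D.apex (e 5) = e 4 := A 4 (hc 4 (by decide) (by decide))
      have e4 : D.apex (e 4) = e 3 := A 3 (hc 3 (by decide) (by decide))
      have e0 : D.apex (e 0) = e 4 := Aj.trans e5
      exact ⟨4, 3, by decide, by rw [← e5, hap, e0, e4]⟩
    · obtain ⟨e0, e5⟩ := A5 h5
      rw [e0, e5] at hap
      by_cases h1 : j = 1
      · subst h1
        exact ⟨4, 5, by decide, by rw [← hap, ← e0, ← A0]; rfl⟩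
      · have h0 : j ≠ 0 := fun h => hxy (h ▸ rfl)
        have : j - 1 ≠ j := by clear * -; revert j; decide
        have := A (j - 1) (hc _ this (by rwa [Ne, sub_eq_zero]))
        rw [sub_add_cancel, hap] at this
        exact ⟨4, j - 1, fun h => h5 (by rw [← sub_add_cancel j 1, ← h]; rfl), this⟩
  subst hj
  have e0 : D.apex (e 0) = e 5 := A 5 (hc 5 (by decide) (by decide))
  have e1 : D.apex (e 1) = e 5 := A0.trans e0
  have e2 : D.apex (e 2) = e 1 := A 1 (hc 1 (by decide) (by decide))
  have e3 : D.apex (e 3) = e 2 := A 2 (hc 2 (by decide) (by decide))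
  have e4 : D.apex (e 4) = e 3 := A 3 (hc 3 (by decide) (by decide))
  have e5 : D.apex (e 5) = e 3 := Aj.trans e4
  have hA : ∀ j, D.apex (e j) = e ((![5, 5, 1, 2, 3, 3] : Fin 6 → Fin 6) j) := by
    intro j; fin_cases j <;> assumption
  refine ⟨valid_of_table he hA (by decide) (by decide), ?_⟩
  refine nonempty_iso_of_table he hA
    ⟨![1, 3, 0, 4, 2, 5], ![2, 0, 4, 1, 3, 5], by decide, by decide⟩ ?_
  simp only [K6MinusP4_adj]
  decide

end base

/-- A non-core vertex followed by another one can be deleted without making two core vertices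
consecutive. At the end the word alternates and has six letters. -/
theorem obtained_of_core_three (W : Type) [Finite W] (D : Strip W)
    (hD : Nat.card {a // D.core a = true} = 3)
    (hD' : ∀ a, D.core a = true → D.core (D.next a) = false) :
    D.Valid ∧ 6 ≤ Nat.card W ∧
      ObtainedBySplittings 6 K6MinusK3 (Nat.card W - 6) D.graph (Set.range D.tri) := by
  refine obtainedBySplittings_of_reduces
    (fun {W} D => Nat.card {a // D.core a = true} = 3 ∧
      ∀ a, D.core a = true → D.core (D.next a) = false) ?_ W D ⟨hD, hD'⟩
  clear hD hD' D
  clear! W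
  rintro W _ D ⟨hD, hD'⟩
  have hsum := D.card_core_add
  obtain ⟨t, ht⟩ := exists_core hD (by omega)
  by_cases hF : ∃ i, D.core i = false ∧ D.core (D.next i) = false
  · obtain ⟨i, hi, hi'⟩ := hF
    refine Or.inr ⟨i, t, hi, ht, core_card_delete.trans hD, fun a ha => ?_⟩
    rw [delete_core] at ha ⊢
    rcases next_delete_eq (hi := hi) (ht := ht) a with h | ⟨-, h⟩
    · rw [h, hD' _ ha]
    · rw [h, hi']
  · left
    have hnot : ∀ a, D.core (D.next a) = !D.core a := by
      intro a
      cases h : D.core a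
      · by_contra h'
        exact hF ⟨a, h, by simpa using h'⟩
      · exact hD' a h
    have hcard : Nat.card {a // D.core a = true} = Nat.card {a // D.core a = false} := by
      apply le_antisymm
      · refine Nat.card_le_card_of_injective
          (fun a => ⟨D.next a, by rw [hnot, a.2]; rfl⟩) fun a b hab => ?_
        exact Subtype.ext (D.next_injective (congrArg Subtype.val hab))
      · refine Nat.card_le_card_of_injective
          (fun a => ⟨D.next a, by rw [hnot, a.2]; rfl⟩) fun a b hab => ?_
        exact Subtype.ext (D.next_injective (congrArg Subtype.val hab))
    have hW : Nat.card W = 6 := by omega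
    exact ⟨hW, base_K6MinusK3 hW (hD' t ht) hnot⟩

/-- The condition `hap` says that the gap containing `y` is the one right after the gap containing
`x`. Deleting any third non-core vertex preserves this, until `x`, `y` and four core vertices are
left. -/
theorem obtained_of_core_four (W : Type) [Finite W] (D : Strip W)
    (hD : Nat.card {a // D.core a = true} = 4) {x y : W} (hx : D.core x = false)
    (hy : D.core y = false) (hxy : x ≠ y) (hap : D.apex x = D.apex (D.apex y)) :
    D.Valid ∧ 6 ≤ Nat.card W ∧
      ObtainedBySplittings 6 K6MinusP4 (Nat.card W - 6) D.graph (Set.range D.tri) := by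
  refine obtainedBySplittings_of_reduces
    (fun {W} D => Nat.card {a // D.core a = true} = 4 ∧ ∃ x y, D.core x = false ∧
      D.core y = false ∧ x ≠ y ∧ D.apex x = D.apex (D.apex y)) ?_ W D ⟨hD, x, y, hx, hy, hxy, hap⟩
  clear hap hxy hx hy hD D
  clear! W
  rintro W _ D ⟨hD, x, y, hx, hy, hxy, hap⟩
  have hsum := D.card_core_add
  obtain ⟨t, ht⟩ := exists_core hD (by omega)
  by_cases hF : ∃ i, D.core i = false ∧ i ≠ x ∧ i ≠ y
  · obtain ⟨i, hi, hix, hiy⟩ := hF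
    refine Or.inr ⟨i, t, hi, ht, core_card_delete.trans hD, ⟨x, hix.symm⟩, ⟨y, hiy.symm⟩, hx, hy,
      fun h => hxy (congrArg Subtype.val h), Subtype.ext hap⟩
  · left
    have hF' : ∀ a, D.core a = false → a = x ∨ a = y := fun a ha => by
      by_contra h
      exact hF ⟨a, ha, by tauto⟩
    have h2 : Nat.card {a // D.core a = false} = 2 := by
      have : {a | D.core a = false} = {x, y} := by
        ext a
        refine ⟨hF' a, ?_⟩
        rintro (rfl | rfl) <;> assumption
      rw [← Set.ncard_pair hxy, ← this]
      rfl
    have hW : Nat.card W = 6 := by omega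
    exact ⟨hW, base_K6MinusP4 hW hx hy hxy hF' hap⟩

end Strip

/-! ### Edge-injective homomorphisms and vertex stickings -/

section EdgeInjective

/-- A graph homomorphism that does not identify edges. -/
structure EdgeInjective {V W : Type*} (F : SimpleGraph V) (G : SimpleGraph W) (φ : V → W) : Prop where
  map_adj : ∀ {a b}, F.Adj a b → G.Adj (φ a) (φ b)
  eq_left : ∀ {a b c d}, F.Adj a b → F.Adj c d → φ a = φ c → φ b = φ d → a = c

variable {V W : Type*} {F : SimpleGraph V} {G : SimpleGraph W} {φ : V → W}

lemma EdgeInjective.of_injective (hφ : Function.Injective φ)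
    (h : ∀ {a b}, F.Adj a b → G.Adj (φ a) (φ b)) : EdgeInjective F G φ :=
  ⟨h, fun _ _ h _ => hφ h⟩

lemma adj_of_mem_clique {s : Finset V} (hs : s ∈ F.cliqueSet 3) {a b : V} (ha : a ∈ s) (hb : b ∈ s)
    (hab : a ≠ b) : F.Adj a b :=
  (mem_cliqueSet_iff.1 hs).isClique ha hb hab

lemma exists_ne_of_mem_clique {s : Finset V} (hs : s ∈ F.cliqueSet 3) (a : V) :
    ∃ b ∈ s, b ≠ a := by
  have : 1 < s.card := by rw [(mem_cliqueSet_iff.1 hs).card_eq]; norm_num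
  exact s.exists_mem_ne this a

open scoped Classical in
lemma EdgeInjective.image_mem_cliqueSet (h : EdgeInjective F G φ) {s : Finset V}
    (hs : s ∈ F.cliqueSet 3) : s.image φ ∈ G.cliqueSet 3 := by
  rw [mem_cliqueSet_iff, is3Clique_iff] at hs ⊢
  obtain ⟨a, b, c, hab, hac, hbc, rfl⟩ := hs
  exact ⟨φ a, φ b, φ c, h.map_adj hab, h.map_adj hac, h.map_adj hbc, by simp⟩

open scoped Classical in
-- A common edge of the images lifts to an edge in each triangle. Applying `eq_left` to the two
-- lifts in both orientations identifies both endpoints.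
lemma EdgeInjective.shares_image (h : EdgeInjective F G φ) {s t : Finset V}
    (hs : s ∈ F.cliqueSet 3) (ht : t ∈ F.cliqueSet 3) :
    Shares (s.image φ) (t.image φ) ↔ Shares s t := by
  constructor
  · rintro ⟨a, b, hab, h1, h2, h3, h4⟩
    simp only [Finset.mem_image] at h1 h2 h3 h4
    obtain ⟨a, ha, rfl⟩ := h1
    obtain ⟨b, hb, rfl⟩ := h2
    obtain ⟨a', ha', h5⟩ := h3
    obtain ⟨b', hb', h6⟩ := h4
    have hne : a ≠ b := fun h => hab (h ▸ rfl)
    have hne' : a' ≠ b' := fun h => hab (by rw [← h5, ← h6, h])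
    have e1 := h.eq_left (adj_of_mem_clique hs ha hb hne) (adj_of_mem_clique ht ha' hb' hne')
      h5.symm h6.symm
    have e2 := h.eq_left (adj_of_mem_clique hs hb ha hne.symm)
      (adj_of_mem_clique ht hb' ha' hne'.symm) h6.symm h5.symm
    exact ⟨a, b, hne, ha, hb, e1 ▸ ha', e2 ▸ hb'⟩
  · rintro ⟨a, b, hab, h1, h2, h3, h4⟩
    exact ⟨φ a, φ b, (h.map_adj (adj_of_mem_clique hs h1 h2 hab)).ne, Finset.mem_image_of_mem _ h1,
      Finset.mem_image_of_mem _ h2, Finset.mem_image_of_mem _ h3, Finset.mem_image_of_mem _ h4⟩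

open scoped Classical in
lemma EdgeInjective.image_inj (h : EdgeInjective F G φ) {s t : Finset V}
    (hs : s ∈ F.cliqueSet 3) (ht : t ∈ F.cliqueSet 3) (hst : s.image φ = t.image φ) : s = t := by
  have hsub : s ⊆ t := by
    intro a ha
    obtain ⟨b, hb, hab⟩ := exists_ne_of_mem_clique hs a
    have hadj := adj_of_mem_clique hs ha hb hab.symm
    have h1 : φ a ∈ t.image φ := hst ▸ Finset.mem_image_of_mem _ ha
    have h2 : φ b ∈ t.image φ := hst ▸ Finset.mem_image_of_mem _ hb
    rw [Finset.mem_image] at h1 h2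
    obtain ⟨a', ha', h5⟩ := h1
    obtain ⟨b', hb', h6⟩ := h2
    have hne' : a' ≠ b' := fun h' => (h.map_adj hadj).ne (by rw [← h5, ← h6, h'])
    rwa [h.eq_left hadj (adj_of_mem_clique ht ha' hb' hne') h5.symm h6.symm]
  refine Finset.eq_of_subset_of_card_le hsub ?_
  rw [(mem_cliqueSet_iff.1 hs).card_eq, (mem_cliqueSet_iff.1 ht).card_eq]

open scoped Classical in
lemma IsTriCycle.image {n : ℕ} {c : Fin n → Finset V} (hc : IsTriCycle F c)
    (h : EdgeInjective F G φ) : IsTriCycle G (fun i => (c i).image φ) := by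
  refine ⟨fun i j hij => hc.injective (h.image_inj (hc.mem i) (hc.mem j) hij),
    fun i => h.image_mem_cliqueSet (hc.mem i), fun i j hij => ?_⟩
  rw [h.shares_image (hc.mem i) (hc.mem j), hc.shares_iff i j hij]

/-- Edge-injective homomorphisms carry induced cycles of the triangle graph along. -/
lemma EdgeInjective.isIndContained {n : ℕ} (h : EdgeInjective F G φ)
    (hF : (cycleGraph n).IsIndContained (triangleGraph F)) :
    (cycleGraph n).IsIndContained (triangleGraph G) := by
  rw [isIndContained_triangleGraph_iff] at *
  obtain ⟨c, hc⟩ := hF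
  exact ⟨_, hc.image h⟩

lemma isIndContained_of_isContained {n : ℕ} (h : F.IsContained G)
    (hF : (cycleGraph n).IsIndContained (triangleGraph F)) :
    (cycleGraph n).IsIndContained (triangleGraph G) := by
  obtain ⟨f⟩ := h
  exact (EdgeInjective.of_injective (φ := f) f.injective fun h => f.toHom.map_adj h).isIndContained hF

end EdgeInjective

section sticking

variable {V W : Type*} {F : SimpleGraph V} {u v : V}

lemma stickMap_eq_iff {a b : V} : stickMap u v a = stickMap u v b ↔
    a = b ∨ (a = u ∨ a = v) ∧ (b = u ∨ b = v) := by
  unfold stickMap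
  by_cases ha : a ≠ u ∧ a ≠ v <;> by_cases hb : b ≠ u ∧ b ≠ v
  · simp only [dif_pos ha, dif_pos hb, Option.some.injEq, Subtype.mk.injEq]
    tauto
  · simp only [dif_pos ha, dif_neg hb, reduceCtorEq, false_iff]
    rintro (rfl | h) <;> tauto
  · simp only [dif_neg ha, dif_pos hb, reduceCtorEq, false_iff]
    rintro (rfl | h) <;> tauto
  · simp only [dif_neg ha, dif_neg hb, true_iff]
    tauto

lemma three_le_edist_iff : 3 ≤ F.edist u v ↔ u ≠ v ∧ ¬ F.Adj u v ∧ ∀ w, F.Adj u w → ¬ F.Adj v w := by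
  have : 3 ≤ F.edist u v ↔ 2 < F.edist u v := by
    rw [← ENat.add_one_le_iff (by simp)]
    norm_num
  rw [this, two_lt_edist_iff, Set.eq_empty_iff_forall_notMem]
  simp [mem_commonNeighbors]

/-- Nonadjacency of `u` and `v` prevents loops; the absence of a common neighbour prevents two edges
from being identified. -/
lemma edgeInjective_stickMap (h : 3 ≤ F.edist u v) :
    EdgeInjective F (stickVertices F u v) (stickMap u v) := by
  obtain ⟨hne, hadj, hcom⟩ := three_le_edist_iff.1 h
  constructor
  · intro a b hab
    refine map_adj_apply' hab ?_
    rw [Ne, stickMap_eq_iff]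
    rintro (rfl | ⟨rfl | rfl, rfl | rfl⟩)
    · exact hab.ne rfl
    · exact hab.ne rfl
    · exact hadj hab
    · exact hadj hab.symm
    · exact hab.ne rfl
  · intro a b c d hab hcd h1 h2
    rw [stickMap_eq_iff] at h1 h2
    grind [SimpleGraph.adj_comm, SimpleGraph.Adj.ne]

lemma ObtainedByStickings.isIndContained {V W : Type} {F : SimpleGraph V} {H : SimpleGraph W} {n : ℕ}
    (h : ObtainedByStickings F H) (hF : (cycleGraph n).IsIndContained (triangleGraph F)) :
    (cycleGraph n).IsIndContained (triangleGraph H) := by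
  induction h with
  | refl => exact hF
  | step _ hs ih =>
    obtain ⟨u, v, huv, ⟨f⟩⟩ := hs
    exact isIndContained_of_isContained ⟨f.toCopy⟩ ((edgeInjective_stickMap huv).isIndContained ih)

end sticking


/-! ### Weak edge splitting lengthens the cycle -/

section cycle

/-- For `i < j` the only adjacency across the seam is between `0` and `n - 1`; in this form `omega`
can handle adjacency. -/
lemma cycleGraph_adj_of_lt {n : ℕ} {i j : Fin n} (hij : i < j) :
    (cycleGraph n).Adj i j ↔ j.1 = i.1 + 1 ∨ i.1 = 0 ∧ j.1 + 1 = n ∧ 2 ≤ n := by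
  have hn : 2 ≤ n := by omega
  have : NeZero n := ⟨by omega⟩
  rw [cycleGraph_adj_iff hn, Fin.ext_iff, Fin.ext_iff, Fin.val_add, Fin.val_add, Fin.val_one',
    Nat.mod_eq_of_lt (show 1 < n by omega)]
  rw [Nat.mod_eq_of_lt (show i.1 + 1 < n by omega)]
  rcases Nat.lt_or_ge (j.1 + 1) n with h | h
  · rw [Nat.mod_eq_of_lt h]; omega
  · have : j.1 + 1 = n := by omega
    rw [this, Nat.mod_self]; omega

variable {V : Type*} {G : SimpleGraph V}

lemma IsTriCycle.of_lt {n : ℕ} {c : Fin n → Finset V} (hinj : ∀ i j, i < j → c i ≠ c j)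
    (hmem : ∀ i, c i ∈ G.cliqueSet 3)
    (h : ∀ i j, i < j → (Shares (c i) (c j) ↔ j.1 = i.1 + 1 ∨ i.1 = 0 ∧ j.1 + 1 = n ∧ 2 ≤ n)) :
    IsTriCycle G c := by
  refine ⟨fun i j hij => ?_, hmem, fun i j hij => ?_⟩
  · by_contra hne
    rcases lt_or_gt_of_ne hne with h | h
    · exact hinj _ _ h hij
    · exact hinj _ _ h hij.symm
  · rcases lt_or_gt_of_ne hij with h' | h'
    · rw [h i j h', cycleGraph_adj_of_lt h']
    · rw [adj_comm, cycleGraph_adj_of_lt h', ← h j i h']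
      exact ⟨Shares.symm, Shares.symm⟩

lemma IsTriCycle.comp {n : ℕ} {c : Fin n → Finset V} (hc : IsTriCycle G c)
    (ρ : cycleGraph n ≃g cycleGraph n) : IsTriCycle G (c ∘ ρ) := by
  refine ⟨hc.injective.comp ρ.injective, fun i => hc.mem _, fun i j hij => ?_⟩
  rw [Function.comp_apply, Function.comp_apply, hc.shares_iff _ _ (ρ.injective.ne hij),
    ρ.map_adj_iff]

/-- The cycle `c` may be renumbered such that a given triangle comes last, and a second one, next to
it, comes first. -/
lemma IsTriCycle.exists_comp {m : ℕ} (hm : 2 ≤ m) {c : Fin (m + 1) → Finset V}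
    (hc : IsTriCycle G c) (i : Fin (m + 1)) :
    ∃ c₁ c₂ : Fin (m + 1) → Finset V, IsTriCycle G c₁ ∧ IsTriCycle G c₂ ∧
      Set.range c₁ = Set.range c ∧ Set.range c₂ = Set.range c ∧ c₁ (Fin.last m) = c i ∧
      c₂ (Fin.last m) = c i ∧ c₂ 0 = c₁ ⟨m - 1, by omega⟩ := by
  -- Both a rotation and a reflection can put the given triangle last; they place its two neighbours
  -- in opposite orders.
  have hadd : ∀ k : Fin (m + 1), ∃ ρ : cycleGraph (m + 1) ≃g cycleGraph (m + 1), ∀ j, ρ j = k + j :=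
    fun k => ⟨⟨Equiv.addLeft k, by
      intro a b
      simp [cycleGraph_adj_iff (n := m + 1) (by omega), add_assoc]⟩, fun j => rfl⟩
  have hsub : ∀ k : Fin (m + 1), ∃ ρ : cycleGraph (m + 1) ≃g cycleGraph (m + 1), ∀ j, ρ j = k - j :=
    fun k => ⟨⟨Equiv.subLeft k, by
      intro a b
      simp only [cycleGraph_adj_iff (n := m + 1) (by omega), Equiv.subLeft_apply]
      rw [sub_eq_iff_eq_add, sub_eq_iff_eq_add]
      constructor
      · rintro (h | h)
        · right; rw [← sub_eq_zero] at h ⊢; rw [← h]; abel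
        · left; rw [← sub_eq_zero] at h ⊢; rw [← h]; abel
      · rintro (rfl | rfl)
        · right; abel
        · left; abel⟩, fun j => rfl⟩
  obtain ⟨ρ, hρ⟩ := hadd (i + 1)
  obtain ⟨τ, hτ⟩ := hsub (i - 1)
  have hlast : Fin.last m + 1 = 0 := Fin.last_add_one m
  have hlast' : (⟨m - 1, by omega⟩ : Fin (m + 1)) + 1 = Fin.last m := by
    ext
    rw [Fin.val_add, Fin.val_one', Nat.mod_eq_of_lt (show 1 < m + 1 by omega)]
    simp only [Fin.val_last]
    rw [Nat.mod_eq_of_lt (by omega)]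
    omega
  refine ⟨c ∘ ρ, c ∘ τ, hc.comp ρ, hc.comp τ, ρ.surjective.range_comp c, τ.surjective.range_comp c,
    ?_, ?_, ?_⟩
  · rw [Function.comp_apply, hρ, add_assoc, add_comm 1, hlast, add_zero]
  · rw [Function.comp_apply, hτ, sub_sub, add_comm 1, hlast, sub_zero]
  · rw [Function.comp_apply, Function.comp_apply, hρ, hτ]
    congr 1
    rw [sub_zero, sub_eq_iff_eq_add, add_assoc, add_assoc, add_comm 1, add_assoc, ← add_assoc _ 1,
      hlast', hlast, add_zero]

end cycle

section splitting

variable {V : Type*} {G : SimpleGraph V} {u v x : V}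

open scoped Classical in
-- The last triangle is replaced by two new ones at positions `m` and `m + 1`, which share the edge
-- from `none` to `x`. The first can meet an old triangle only in `ux`, hence only the one at `m -
-- 1`; the second only in `vx`, hence only the one at `0`. The old triangles avoid `uv` and so
-- survive.
lemma isTriCycle_split {m : ℕ} (hm : 3 ≤ m) {c : Fin (m + 1) → Finset V} (hc : IsTriCycle G c)
    (huv : G.Adj u v) (huniq : ∀ i, u ∈ c i → v ∈ c i → i = Fin.last m)
    (hlast : c (Fin.last m) = {u, v, x}) (h0 : v ∈ c 0 ∧ x ∈ c 0)
    (h1 : u ∈ c ⟨m - 1, by omega⟩ ∧ x ∈ c ⟨m - 1, by omega⟩) :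
    ∃ c' : Fin (m + 2) → Finset (Option V), IsTriCycle (splitEdge G u v x) c' ∧
      Set.range c' = splitTriangles (Set.range c) u v x := by
  have hcl := hc.mem (Fin.last m)
  rw [hlast] at hcl
  obtain ⟨-, hux, hvx⟩ : G.Adj u v ∧ G.Adj u x ∧ G.Adj v x := by
    rwa [mem_cliqueSet_iff, is3Clique_triple_iff] at hcl
  have hnot : ∀ i : Fin (m + 1), i.1 < m → ¬ (u ∈ c i ∧ v ∈ c i) := by
    intro i hi h
    have := huniq i h.1 h.2
    rw [this] at hi
    exact lt_irrefl _ hi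
  have hU : ∀ i : Fin (m + 1), i.1 < m → (u ∈ c i ∧ x ∈ c i ↔ i.1 + 1 = m) := by
    intro i hi
    constructor
    · rintro ⟨hu, hx⟩
      have h := (hc.shares_iff i (Fin.last m) (Fin.ne_of_lt hi)).1
        ⟨u, x, hux.ne, hu, hx, by simp [hlast], by simp [hlast]⟩
      rw [cycleGraph_adj_of_lt (show i < Fin.last m from hi)] at h
      rcases h with h | h
      · exact h.symm
      · have : i = 0 := Fin.ext h.1
        subst this
        exact absurd ⟨hu, h0.1⟩ (hnot _ hi)
    · intro h
      have : i = ⟨m - 1, by omega⟩ := Fin.ext (by simp; omega)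
      rwa [this]
  have hV : ∀ i : Fin (m + 1), i.1 < m → (v ∈ c i ∧ x ∈ c i ↔ i.1 = 0) := by
    intro i hi
    constructor
    · rintro ⟨hv, hx⟩
      have h := (hc.shares_iff i (Fin.last m) (Fin.ne_of_lt hi)).1
        ⟨v, x, hvx.ne, hv, hx, by simp [hlast], by simp [hlast]⟩
      rw [cycleGraph_adj_of_lt (show i < Fin.last m from hi)] at h
      rcases h with h | h
      · have : i = ⟨m - 1, by omega⟩ := Fin.ext (by simp at h ⊢; omega)
        rw [this] at hv hi
        exact absurd ⟨h1.1, hv⟩ (hnot _ hi)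
      · exact h.1
    · intro h
      have : i = 0 := Fin.ext h
      rwa [this]
  have hA : ∀ {s : Finset V} {y : V} (_ : y ≠ x),
      Shares (s.map Function.Embedding.some) {some y, none, some x} ↔ y ∈ s ∧ x ∈ s := by
    intro s y hyx
    constructor
    · rintro ⟨a, b, hab, ha, hb, ha', hb'⟩
      simp only [Finset.mem_map, Function.Embedding.some_apply] at ha hb
      obtain ⟨a, ha, rfl⟩ := ha
      obtain ⟨b, hb, rfl⟩ := hb
      simp at ha' hb' hab
      rcases ha' with rfl | rfl <;> rcases hb' with rfl | rfl <;> first | exact absurd rfl hab | exact ⟨‹_›, ‹_›⟩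
    · rintro ⟨h1, h2⟩
      exact ⟨some y, some x, by simpa using hyx, by simpa, by simpa, by simp, by simp⟩
  have hB : ({none, some v, some x} : Finset (Option V)) = {some v, none, some x} :=
    Finset.insert_comm _ _ _
  let c' : Fin (m + 2) → Finset (Option V) := fun i =>
    if h : i.1 < m then (c ⟨i.1, by omega⟩).map Function.Embedding.some
    else if i.1 = m then {some u, none, some x} else {none, some v, some x}
  have c1 : ∀ i : Fin (m + 2), ∀ h : i.1 < m,
      c' i = (c ⟨i.1, by omega⟩).map Function.Embedding.some := fun i h => dif_pos h
  have c2 : ∀ i : Fin (m + 2), i.1 = m → c' i = {some u, none, some x} := fun i h => by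
    simp [c', h]
  have c3 : ∀ i : Fin (m + 2), i.1 = m + 1 → c' i = {some v, none, some x} := fun i h => by
    simp [c', h, hB]
  have hcases : ∀ i : Fin (m + 2), i.1 < m ∨ i.1 = m ∨ i.1 = m + 1 := fun i => by omega
  have hnone : ∀ s : Finset V, none ∉ s.map Function.Embedding.some := fun s => by simp
  refine ⟨c', IsTriCycle.of_lt ?_ ?_ ?_, ?_⟩
  · intro i j hij heq
    have hij' : i.1 < j.1 := hij
    rcases hcases i with hi | hi | hi <;> rcases hcases j with hj | hj | hj <;> try omega
    · rw [c1 i hi, c1 j hj] at heq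
      have := hc.injective (Finset.map_injective _ heq)
      simp at this
      omega
    · rw [c1 i hi, c2 j hj] at heq
      refine hnone (c ⟨i.1, by omega⟩) ?_
      rw [heq]; simp
    · rw [c1 i hi, c3 j hj] at heq
      refine hnone (c ⟨i.1, by omega⟩) ?_
      rw [heq]; simp
    · rw [c2 i hi, c3 j hj] at heq
      have : some u ∈ ({some v, none, some x} : Finset (Option V)) := heq ▸ by simp
      simp [huv.ne, hux.ne] at this
  · intro i
    rcases hcases i with hi | hi | hi
    · rw [c1 i hi]
      have h3 := hc.mem ⟨i.1, by omega⟩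
      have hn := hnot ⟨i.1, by omega⟩ hi
      generalize c ⟨i.1, by omega⟩ = s at h3 hn
      have hadj : ∀ a ∈ s, ∀ b ∈ s, a ≠ b → (splitEdge G u v x).Adj (some a) (some b) := by
        intro a ha b hb hab
        rw [splitEdge_some_some]
        refine ⟨adj_of_mem_clique h3 ha hb hab, fun h => hn ?_⟩
        rw [Sym2.eq_iff] at h
        rcases h with ⟨rfl, rfl⟩ | ⟨rfl, rfl⟩
        · exact ⟨ha, hb⟩
        · exact ⟨hb, ha⟩
      rw [mem_cliqueSet_iff, isNClique_iff, Finset.card_map, (mem_cliqueSet_iff.1 h3).card_eq]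
      refine ⟨?_, rfl⟩
      intro a ha b hb hab
      simp only [Finset.coe_map, Set.mem_image, Function.Embedding.some_apply, Finset.mem_coe] at ha hb
      obtain ⟨a, ha, rfl⟩ := ha
      obtain ⟨b, hb, rfl⟩ := hb
      exact hadj a ha b hb fun h => hab (h ▸ rfl)
    · rw [c2 i hi, mem_cliqueSet_iff, is3Clique_triple_iff, (splitEdge _ _ _ _).adj_comm,
        splitEdge_none_some, splitEdge_some_some, splitEdge_none_some]
      simp [hux, hvx.ne.symm, hux.ne.symm]
    · rw [c3 i hi, mem_cliqueSet_iff, is3Clique_triple_iff, (splitEdge _ _ _ _).adj_comm,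
        splitEdge_none_some, splitEdge_some_some, splitEdge_none_some]
      simp [hvx, hvx.ne.symm, hux.ne.symm]
  · intro i j hij
    have hij' : i.1 < j.1 := hij
    rcases hcases i with hi | hi | hi <;> rcases hcases j with hj | hj | hj <;> try omega
    · rw [c1 i hi, c1 j hj]
      have : ∀ s t : Finset V, Shares (s.map Function.Embedding.some) (t.map Function.Embedding.some) ↔
          Shares s t := by
        intro s t
        constructor
        · rintro ⟨a, b, hab, h1, h2, h3, h4⟩
          simp only [Finset.mem_map, Function.Embedding.some_apply] at h1 h2
          obtain ⟨a, ha, rfl⟩ := h1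
          obtain ⟨b, hb, rfl⟩ := h2
          exact ⟨a, b, fun h => hab (h ▸ rfl), ha, hb, by simpa using h3, by simpa using h4⟩
        · rintro ⟨a, b, hab, h1, h2, h3, h4⟩
          exact ⟨some a, some b, by simpa using hab, by simpa, by simpa, by simpa, by simpa⟩
      rw [this, hc.shares_iff _ _ (by simp; omega), cycleGraph_adj_of_lt (by exact hij)]
      simp only
      omega
    · rw [c1 i hi, c2 j hj, hA hux.ne, hU _ hi]
      simp only
      omega
    · rw [c1 i hi, c3 j hj, hA hvx.ne, hV _ hi]
      simp only
      omega
    · rw [c2 i hi, c3 j hj]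
      exact iff_of_true ⟨none, some x, by simp, by simp, by simp, by simp, by simp⟩ (by omega)
  · have hmem : ∀ i : Fin (m + 1), i.1 < m → c i ≠ {u, v, x} := by
      intro i hi h
      exact hnot i hi (by simp [h])
    ext T
    constructor
    · rintro ⟨i, rfl⟩
      rcases hcases i with hi | hi | hi
      · rw [c1 i hi]
        exact Or.inl ⟨_, ⟨⟨_, rfl⟩, hmem _ hi⟩, rfl⟩
      · rw [c2 i hi]
        exact Or.inr (Or.inl rfl)
      · rw [c3 i hi, ← hB]
        exact Or.inr (Or.inr rfl)
    · rintro (⟨_, ⟨⟨i, rfl⟩, hi⟩, rfl⟩ | (rfl | rfl))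
      · have hlt : i.1 < m := by
          rcases Nat.lt_or_ge i.1 m with h | h
          · exact h
          · have : i = Fin.last m := Fin.ext (by simp; omega)
            subst this
            exact absurd hlast hi
        exact ⟨⟨i.1, by omega⟩, c1 ⟨i.1, by omega⟩ hlt⟩
      · exact ⟨⟨m, by omega⟩, c2 _ rfl⟩
      · exact ⟨⟨m + 1, by omega⟩, (c3 _ rfl).trans hB.symm⟩

/-- Weak edge splitting preserves the property of the cycle-triangles and lengthens the cycle. -/
theorem IsWeakEdgeSplitting.isInducedTriangleCycle {W : Type*} {H : SimpleGraph W}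
    {S : Set (Finset V)} {S' : Set (Finset W)} {n : ℕ} (hn : 4 ≤ n)
    (h : IsWeakEdgeSplitting G S H S') (hS : IsInducedTriangleCycle n G S) :
    IsInducedTriangleCycle (n + 1) H S' := by
  classical
  obtain ⟨u, v, x, huv, hmem, huniq, f, rfl⟩ := h
  obtain ⟨m, rfl⟩ : ∃ m, n = m + 1 := ⟨n - 1, by omega⟩
  rw [isInducedTriangleCycle_iff] at hS ⊢
  obtain ⟨c, hc, rfl⟩ := hS
  suffices ∃ c' : Fin (m + 2) → Finset (Option V), IsTriCycle (splitEdge G u v x) c' ∧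
      Set.range c' = splitTriangles (Set.range c) u v x by
    obtain ⟨c', hc', hr⟩ := this
    refine ⟨fun i => (c' i).image f, hc'.image (EdgeInjective.of_injective f.injective
      fun h => f.map_adj_iff.2 h), ?_⟩
    rw [← hr, ← Set.range_comp]
    congr 1
    funext i
    simp [Finset.map_eq_image]
  obtain ⟨i, hi⟩ := hmem
  have hi : c i = {u, v, x} := by rw [hi]
  obtain ⟨c₁, c₂, h₁, h₂, r₁, r₂, l₁, l₂, hz⟩ := hc.exists_comp (by omega) i
  rw [hi] at l₁ l₂
  -- As `uv` lies in no other cycle-triangle, each neighbour of the split triangle contains `vx` or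
  -- `ux`.
  have key : ∀ d : Fin (m + 1) → Finset V, IsTriCycle G d → Set.range d = Set.range c →
      d (Fin.last m) = {u, v, x} → (∀ i, u ∈ d i → v ∈ d i → i = Fin.last m) ∧
      ∀ i, i ≠ Fin.last m → Shares (d i) (d (Fin.last m)) →
        v ∈ d i ∧ x ∈ d i ∨ u ∈ d i ∧ x ∈ d i := by
    intro d hd hr hl
    have hu : ∀ i, u ∈ d i → v ∈ d i → i = Fin.last m := by
      intro i hu hv
      refine hd.injective ?_
      rw [huniq (d i) (hr ▸ ⟨i, rfl⟩) hu hv, hl]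
    refine ⟨hu, fun i hi => ?_⟩
    rintro ⟨a, b, hab, ha, hb, ha', hb'⟩
    rw [hl] at ha' hb'
    simp only [Finset.mem_insert, Finset.mem_singleton] at ha' hb'
    have := hu i
    grind
  obtain ⟨k1, k2⟩ := key c₁ h₁ r₁ l₁
  obtain ⟨k3, k4⟩ := key c₂ h₂ r₂ l₂
  have s0 : ∀ d : Fin (m + 1) → Finset V, IsTriCycle G d → Shares (d 0) (d (Fin.last m)) := by
    intro d hd
    have h0 : (0 : Fin (m + 1)) < Fin.last m := by rw [Fin.lt_def]; simp; omega
    rw [hd.shares_iff _ _ h0.ne, cycleGraph_adj_of_lt h0]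
    simp; omega
  have s1 : ∀ d : Fin (m + 1) → Finset V, IsTriCycle G d →
      Shares (d ⟨m - 1, by omega⟩) (d (Fin.last m)) := by
    intro d hd
    have h0 : (⟨m - 1, by omega⟩ : Fin (m + 1)) < Fin.last m := by rw [Fin.lt_def]; simp; omega
    rw [hd.shares_iff _ _ h0.ne, cycleGraph_adj_of_lt h0]
    simp; omega
  have n0 : (0 : Fin (m + 1)) ≠ Fin.last m := by rw [Ne, Fin.ext_iff]; simp; omega
  have n1 : (⟨m - 1, by omega⟩ : Fin (m + 1)) ≠ Fin.last m := by rw [Ne, Fin.ext_iff]; simp; omega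
  -- The two neighbours are not adjacent in a cycle of length at least 4, so they use different
  -- sides.
  have hne : ∀ d : Fin (m + 1) → Finset V, IsTriCycle G d → d (Fin.last m) = {u, v, x} →
      ¬ Shares (d 0) (d ⟨m - 1, by omega⟩) := by
    intro d hd _ hs
    have h0 : (0 : Fin (m + 1)) < ⟨m - 1, by omega⟩ := by rw [Fin.lt_def]; simp; omega
    rw [hd.shares_iff _ _ h0.ne, cycleGraph_adj_of_lt h0] at hs
    simp at hs; omega
  have hcl := hc.mem i
  rw [hi, mem_cliqueSet_iff, is3Clique_triple_iff] at hcl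
  rcases k2 0 n0 (s0 _ h₁) with h0 | h0 <;> rcases k2 _ n1 (s1 _ h₁) with h1 | h1
  · exact absurd ⟨v, x, hcl.2.2.ne, h0.1, h0.2, h1.1, h1.2⟩ (hne _ h₁ l₁)
  · rw [← r₁]
    exact isTriCycle_split (by omega) h₁ huv k1 l₁ h0 h1
  -- The sides come in the wrong order, so the reflected numbering `c₂` is used.
  · rw [← hz] at h1
    rcases k4 _ n1 (s1 _ h₂) with h2 | h2
    · exact absurd ⟨v, x, hcl.2.2.ne, h1.1, h1.2, h2.1, h2.2⟩ (hne _ h₂ l₂)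
    · rw [← r₂]
      exact isTriCycle_split (by omega) h₂ huv k3 l₂ h1 h2
  · exact absurd ⟨u, x, hcl.2.1.ne, h0.1, h0.2, h1.1, h1.2⟩ (hne _ h₁ l₁)

end splitting

theorem ObtainedBySplittings.isInducedTriangleCycle {V : Type} {m k : ℕ} {B : SimpleGraph V}
    {W : Type} {H : SimpleGraph W} {S : Set (Finset W)} (hm : 4 ≤ m)
    (h : ObtainedBySplittings m B k H S) : IsInducedTriangleCycle (m + k) H S := by
  induction h with
  | start _ h => exact h
  | @step k _ _ _ _ _ _ _ h ih =>
    exact h.isInducedTriangleCycle (show 4 ≤ m + k by omega) ih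


/-! ### Factoring edge-injective maps through stickings -/

/-- The image of an edge-injective homomorphism contains a graph obtained by weak vertex
stickings. -/
theorem EdgeInjective.exists_stickings {U V : Type} [Finite V] {W : Type*} {F₀ : SimpleGraph U}
    {F : SimpleGraph V} {G : SimpleGraph W} {φ : V → W} (h : EdgeInjective F G φ)
    (hF : ObtainedByStickings F₀ F) :
    ∃ (X : Type) (H : SimpleGraph X), ObtainedByStickings F₀ H ∧ H.IsContained G := by
  induction hn : Nat.card V using Nat.strong_induction_on generalizing V with
  | _ n ih =>
    by_cases hinj : Function.Injective φ
    · exact ⟨V, F, hF, ⟨⟨φ, fun hab => h.map_adj hab⟩, hinj⟩⟩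
    · simp only [Function.Injective, not_forall] at hinj
      obtain ⟨u, v, huv, hne⟩ := hinj
      -- A common neighbour `w` would give edges `uw` and `vw` with the same image.
      have h3 : 3 ≤ F.edist u v := by
        rw [three_le_edist_iff]
        refine ⟨hne, fun hadj => (h.map_adj hadj).ne huv, fun w hu hv => hne ?_⟩
        exact h.eq_left hu hv huv rfl
      let ψ : Option {a : V // a ≠ u ∧ a ≠ v} → W := fun a => a.elim (φ u) fun a => φ a
      have hψ : ∀ a, ψ (stickMap u v a) = φ a := by
        intro a
        by_cases ha : a ≠ u ∧ a ≠ v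
        · simp [stickMap, ha, ψ]
        · have : stickMap u v a = none := by rw [stickMap, dif_neg ha]
          rw [this]
          have : a = u ∨ a = v := by tauto
          rcases this with rfl | rfl
          · rfl
          · exact huv
      refine ih (Nat.card (Option {a : V // a ≠ u ∧ a ≠ v})) ?_ (V := Option _)
        (F := stickVertices F u v) (φ := ψ) ⟨?_, ?_⟩
        (.step hF ⟨u, v, h3, ⟨Iso.refl⟩⟩) rfl
      · rw [← hn]
        have := Fintype.ofFinite V
        have := Fintype.ofFinite (Option {a : V // a ≠ u ∧ a ≠ v})
        rw [Nat.card_eq_fintype_card, Nat.card_eq_fintype_card]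
        refine Fintype.card_lt_of_injective_not_surjective
          (fun a : Option {a : V // a ≠ u ∧ a ≠ v} => a.elim u Subtype.val) ?_ ?_
        · rintro (_ | ⟨a, ha⟩) (_ | ⟨b, hb⟩) hab
          · rfl
          · exact absurd hab.symm hb.1
          · exact absurd hab ha.1
          · simpa using hab
        · intro hs
          obtain ⟨_ | ⟨a, ha⟩, hav⟩ := hs v
          · exact hne hav
          · exact ha.2 hav
      · intro a b hab
        obtain ⟨-, a, b, hab', rfl, rfl⟩ := map_adj' _ _ _ _ |>.1 hab
        rw [hψ, hψ]
        exact h.map_adj hab'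
      · intro a b c d hab hcd h1 h2
        obtain ⟨-, a, b, hab', rfl, rfl⟩ := map_adj' _ _ _ _ |>.1 hab
        obtain ⟨-, c, d, hcd', rfl, rfl⟩ := map_adj' _ _ _ _ |>.1 hcd
        rw [hψ, hψ] at h1 h2
        rw [h.eq_left hab' hcd' h1 h2]

/-! ### Proper strips and the number of core vertices -/

namespace Strip

/-- The triangles of the strip are nondegenerate, and only consecutive ones share an edge. -/
structure Proper {W : Type*} (D : Strip W) : Prop where
  apex_ne : ∀ k, D.apex k ≠ k
  consecutive : ∀ k l, k ≠ l → Shares (D.tri k) (D.tri l) → l = D.next k ∨ k = D.next l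

variable {W : Type*} {D : Strip W}

/-- On core vertices `apex` is the step to the preceding core vertex, so it permutes them in a
single cycle. The enumeration runs backwards along the strip. -/
lemma exists_core_enumeration [Finite W] {m : ℕ} [NeZero m]
    (hm : Nat.card {a // D.core a = true} = m) (t : W) (ht : D.core t = true) :
    ∃ e : Fin m ≃ {a // D.core a = true}, (e 0 : W) = t ∧
      ∀ j, D.apex (e j) = e (j + 1) := by
  have := Fintype.ofFinite {a // D.core a = true}
  rw [Nat.card_eq_fintype_card] at hm
  have htr : ∀ s : Set {a // D.core a = true}, s.Nonempty →
      (∀ a ∈ s, (⟨D.apex a, core_apex ht a⟩ : {a // D.core a = true}) ∈ s) → s = Set.univ := by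
    rintro s ⟨a, ha⟩ hs
    by_contra hne
    obtain ⟨b, hb⟩ := (Set.ne_univ_iff_exists_notMem s).1 hne
    -- Along the strip the apex never enters `s`: it starts at `b`, and it can change only to a core
    -- vertex whose own apex is outside `s`, which by invariance is itself outside `s`.
    have key : ∀ k, (⟨D.apex k, core_apex ht k⟩ : {a // D.core a = true}) ∉ s := by
      refine D.induction (D.next b) ?_ fun k hk => ?_
      · simpa only [apex_next_of_core b.2] using hb
      · cases hc : D.core k
        · simpa only [apex_next_of_not_core hc] using hk
        · simp only [apex_next_of_core hc]
          exact fun h => hk (hs _ h)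
    exact key a (hs a ha)
  obtain ⟨e, h0, he⟩ := exists_equiv_fin hm _ htr ⟨t, ht⟩
  exact ⟨e, by rw [h0], fun j => congrArg Subtype.val (he j)⟩

/-- The edge from `x` to `apex x` is common to the triangle of `x` and the preceding one, so a
triangle containing it meets both. -/
lemma shares_of_next {k x y : W} {s : Finset W} (hxy : x ≠ y) (hx : x = D.next k)
    (hy : y = D.apex x) (hxs : x ∈ s) (hys : y ∈ s) :
    Shares (D.tri k) s ∧ Shares (D.tri x) s := by
  subst hx hy
  exact ⟨⟨_, _, hxy, (tri_inter_left k).1, (tri_inter_left k).2, hxs, hys⟩,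
    ⟨_, _, hxy, (tri_inter_right k).1, (tri_inter_right k).2, hxs, hys⟩⟩

/-- A single core vertex would be its own apex. -/
lemma Proper.core_card_ne_one [Finite W] (h : D.Proper) :
    Nat.card {a // D.core a = true} ≠ 1 := by
  intro hm
  obtain ⟨t, ht⟩ := exists_core hm one_pos
  obtain ⟨e, -, he⟩ := exists_core_enumeration hm t ht
  refine h.apex_ne (e 0) ?_
  rw [he]
  rfl

/-- Two core vertices `a`, `b` are each other's apex, so the edge `ab` lies on the triangles of `a`,
of `b` and of their predecessors. At least three of these are distinct, but three triangles of a
strip with four or more vertices are not pairwise consecutive. -/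
lemma Proper.core_card_ne_two [Finite W] (h : D.Proper) (hW : 4 ≤ Nat.card W) :
    Nat.card {a // D.core a = true} ≠ 2 := by
  intro hm
  obtain ⟨t, ht⟩ := exists_core hm two_pos
  obtain ⟨e, -, he⟩ := exists_core_enumeration hm t ht
  have ha : D.apex (e 0) = e 1 := he 0
  have hb : D.apex (e 1) = e 0 := he 1
  have hab : (e 0 : W) ≠ e 1 := fun h => by
    have := e.injective (Subtype.ext h)
    simp at this
  generalize (e 0 : W) = a at *
  generalize (e 1 : W) = b at *
  have h1 := fun k => D.iterate_next_ne (j := 1) (by omega) (by omega) k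
  have h2 := fun k => D.iterate_next_ne (j := 2) (by omega) (by omega) k
  have h3 := fun k => D.iterate_next_ne (j := 3) (by omega) (by omega) k
  simp only [Function.iterate_succ_apply, Function.iterate_zero_apply] at h1 h2 h3
  obtain ⟨a', rfl⟩ := D.next_surjective a
  have hmem : D.next a' ∈ D.tri b ∧ b ∈ D.tri b := by simp [mem_tri, hb]
  obtain ⟨s1, s2⟩ := shares_of_next hab rfl ha.symm hmem.1 hmem.2
  have c2 := h.consecutive _ _ hab s2
  by_cases hab' : a' = b
  · subst hab'
    obtain ⟨b', rfl⟩ := D.next_surjective a'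
    have hmem : D.next (D.next b') ∈ D.tri (D.next (D.next b')) ∧
      D.next b' ∈ D.tri (D.next (D.next b')) := by simp [mem_tri, ha]
    have s3 := (shares_of_next hab.symm rfl hb.symm hmem.2 hmem.1).1
    rcases h.consecutive _ _ (h2 _).symm s3 with h | h
    · exact hab (D.next_injective h ▸ h)
    · exact h3 _ h.symm
  · have c1 := h.consecutive _ _ hab' s1
    rcases c1 with rfl | rfl
    · exact hab rfl
    · rcases c2 with h | h
      · exact h3 _ h.symm
      · exact h1 _ h

/-- If `b = next a` were core as well and `c` is the third core vertex, the edge `bc` would lie on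
the triangle of `a`, on that of `c` and on the one before it. Three triangles cannot be pairwise
consecutive here. -/
lemma Proper.not_core_next [Finite W] (h : D.Proper) (hW : 4 ≤ Nat.card W)
    (hm : Nat.card {a // D.core a = true} = 3) {a : W} (ha : D.core a = true) :
    D.core (D.next a) = false := by
  by_contra hb
  rw [Bool.not_eq_false] at hb
  obtain ⟨e, he0, he⟩ := exists_core_enumeration hm (D.next a) hb
  have h0 := he 0
  have h1 : D.apex (e 1) = e 2 := he 1
  have h2 : D.apex (e 2) = e 0 := he 2
  rw [he0, apex_next_of_core ha, zero_add] at h0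
  rw [← h0] at h1
  rw [he0] at h2
  have hac : a ≠ e 2 := fun h => by
    rw [h0] at h
    have := e.injective (Subtype.ext h)
    simp at this
  have hbc : (e 2 : W) ≠ D.next a := fun h => by
    rw [← he0] at h
    have := e.injective (Subtype.ext h)
    simp at this
  generalize (e 2 : W) = c at *
  obtain ⟨c', rfl⟩ := D.next_surjective c
  have hmem : D.next c' ∈ D.tri a ∧ D.next a ∈ D.tri a := by simp [mem_tri, h1]
  obtain ⟨s1, s2⟩ := shares_of_next hbc rfl h2.symm hmem.1 hmem.2
  have hca : c' ≠ a := by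
    rintro rfl
    exact hbc rfl
  have c1 := h.consecutive _ _ hca s1
  have c2 := h.consecutive _ _ hac.symm s2
  have h3 := D.iterate_next_ne (j := 3) (by omega) (by omega) a
  simp only [Function.iterate_succ_apply, Function.iterate_zero_apply] at h3
  rcases c1 with c1 | rfl
  · exact hac c1
  · rcases c2 with c2 | c2
    · exact h3 c2.symm
    · exact hbc c2

/-- If two opposite gaps between the four core vertices were empty, the triangles of the core
vertices at which these gaps begin would share an edge without being consecutive. So each opposite
pair contains a nonempty gap, and gaps from different pairs are neighbours. -/
lemma Proper.exists_not_core [Finite W] (h : D.Proper)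
    (hm : Nat.card {a // D.core a = true} = 4) :
    ∃ x y, D.core x = false ∧ D.core y = false ∧ x ≠ y ∧ D.apex x = D.apex (D.apex y) := by
  obtain ⟨t, ht⟩ := exists_core hm (by norm_num)
  obtain ⟨e, he0, he⟩ := exists_core_enumeration hm t ht
  have hne : ∀ i j, i ≠ j → (e i : W) ≠ e j := fun i j hij h =>
    hij (e.injective (Subtype.ext h))
  have key : ∀ j, D.next (e (j + 1)) ≠ e j →
      D.core (D.next (e (j + 1))) = false ∧ D.apex (D.next (e (j + 1))) = e (j + 1) := by
    intro j hj
    have h1 := apex_next_of_core (e (j + 1)).2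
    refine ⟨?_, h1⟩
    by_contra hc
    rw [Bool.not_eq_false] at hc
    obtain ⟨i, hi⟩ := e.surjective ⟨_, hc⟩
    have h2 := he i
    rw [hi, h1] at h2
    have := add_right_cancel (e.injective (Subtype.ext h2))
    subst this
    exact hj (by rw [hi])
  have main : ∀ j, ∃ i, (i = j + 1 ∨ i = j + 3) ∧ ∃ x, D.core x = false ∧ D.apex x = e i := by
    intro j
    by_cases h1 : D.next (e (j + 1)) = e j
    · by_cases h2 : D.next (e (j + 3)) = e (j + 2)
      · exfalso
        have n1 : (e (j + 1) : W) ≠ e (j + 3) := hne _ _ (by clear * -; revert j; decide)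
        have n2 : (e j : W) ≠ e (j + 2) := hne _ _ (by clear * -; revert j; decide)
        have a1 : D.apex (e (j + 1)) = e (j + 2) := by rw [he]; congr 2; clear * -; revert j; decide
        have a3 : D.apex (e (j + 3)) = e j := by rw [he]; congr 2; clear * -; revert j; decide
        have n3 : (e (j + 3) : W) ≠ e j := hne _ _ (by clear * -; revert j; decide)
        have n4 : (e (j + 1) : W) ≠ e (j + 2) := hne _ _ (by clear * -; revert j; decide)
        rcases h.consecutive _ _ n1 ⟨e j, e (j + 2), n2, by simp [mem_tri, h1],
          by simp [mem_tri, a1], by simp [mem_tri, a3], by simp [mem_tri, h2]⟩ with h | h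
        · exact n3 (h.trans h1)
        · exact n4 (h.trans h2)
      · have := key (j + 2) (by rwa [show j + 2 + 1 = j + 3 by clear * -; revert j; decide])
        rw [show j + 2 + 1 = j + 3 by clear * -; revert j; decide] at this
        exact ⟨_, Or.inr rfl, _, this⟩
    · exact ⟨_, Or.inl rfl, _, key j h1⟩
  obtain ⟨i, hi, x, hx, hxi⟩ := main 0
  obtain ⟨j, hj, y, hy, hyj⟩ := main 1
  have hij : i ≠ j := by clear * - hi hj; revert i j; decide
  have hxy : x ≠ y := by
    rintro rfl
    exact hne i j hij (hxi.symm.trans hyj)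
  have : i = j + 1 ∨ j = i + 1 := by clear * - hi hj; revert i j; decide
  rcases this with rfl | rfl
  · exact ⟨x, y, hx, hy, hxy, by rw [hxi, hyj, he]⟩
  · exact ⟨y, x, hy, hx, hxy.symm, by rw [hxi, hyj, he]⟩

/-- The graph of every proper strip with a core vertex arises by weak edge splittings. -/
theorem Proper.classification {W : Type} [Finite W] {D : Strip W} (h : D.Proper)
    (hW : 4 ≤ Nat.card W) {t : W} (ht : D.core t = true) :
    D.Valid ∧ ((∃ m, 5 ≤ m ∧ m ≤ Nat.card W ∧
        ObtainedBySplittings m (cycleSquare m) (Nat.card W - m) D.graph (Set.range D.tri)) ∨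
      6 ≤ Nat.card W ∧
        ObtainedBySplittings 6 K6MinusK3 (Nat.card W - 6) D.graph (Set.range D.tri) ∨
      6 ≤ Nat.card W ∧
        ObtainedBySplittings 6 K6MinusP4 (Nat.card W - 6) D.graph (Set.range D.tri)) := by
  have h0 : 0 < Nat.card {a // D.core a = true} := Nat.card_pos_iff.2 ⟨⟨⟨t, ht⟩⟩, inferInstance⟩
  have h1 := h.core_card_ne_one
  have h2 := h.core_card_ne_two hW
  by_cases h3 : Nat.card {a // D.core a = true} = 3
  · obtain ⟨hv, h'⟩ := obtained_of_core_three W D h3 fun a ha => h.not_core_next hW h3 ha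
    exact ⟨hv, Or.inr (Or.inl h')⟩
  by_cases h4 : Nat.card {a // D.core a = true} = 4
  · obtain ⟨x, y, hx, hy, hxy, hap⟩ := h.exists_not_core h4
    obtain ⟨hv, h'⟩ := obtained_of_core_four W D h4 hx hy hxy hap
    exact ⟨hv, Or.inr (Or.inr h')⟩
  · have h5 : 5 ≤ Nat.card {a // D.core a = true} := by omega
    obtain ⟨hv, h'⟩ := obtained_of_five_le h5 W D rfl
    exact ⟨hv, Or.inl ⟨_, h5, h'⟩⟩

end Strip

/-! ### Cyclic words and their strips -/

lemma fin_add_ne {n : ℕ} [NeZero n] (hn : 4 ≤ n) (i : Fin n) :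
    i + 1 ≠ i ∧ i + 1 + 1 ≠ i ∧ i + 1 + 1 + 1 ≠ i := by
  obtain ⟨m, rfl⟩ := Nat.exists_eq_add_of_le' hn
  simp only [add_assoc, ne_eq, add_eq_left]
  simp [Fin.ext_iff, Fin.val_add]
  rw [Nat.mod_eq_of_lt (by omega), Nat.mod_eq_of_lt (by omega)]
  omega

lemma fin_eq_univ {n : ℕ} [NeZero n] (s : Set (Fin n)) (hs : s.Nonempty)
    (h : ∀ k ∈ s, k + 1 ∈ s) : s = Set.univ := by
  obtain ⟨m, rfl⟩ := Nat.exists_eq_succ_of_ne_zero (NeZero.ne n)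
  obtain ⟨a, ha⟩ := hs
  have key : ∀ j, a + j ∈ s := by
    intro j
    refine Fin.induction (motive := fun j => a + j ∈ s) (by simpa using ha) (fun j hj => ?_) j
    rw [← Fin.coeSucc_eq_succ, ← add_assoc]
    exact h _ hj
  ext k
  simpa using key (k - a)

lemma fin_cyclic_induction {n : ℕ} [NeZero n] {P : Fin n → Prop} (k₀ : Fin n) (h₀ : P k₀)
    (h : ∀ k, P k → P (k + 1)) (k : Fin n) : P k :=
  (fin_eq_univ {k | P k} ⟨k₀, h₀⟩ h).symm.subset (Set.mem_univ k)

/-- Every cyclic word with at least one core position is the word of a strip. -/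
lemma exists_strip {n : ℕ} [NeZero n] (core : Fin n → Bool) (t : Fin n) (ht : core t = true) :
    ∃ D : Strip (Fin n), (∀ k, D.next k = k + 1) ∧ D.core = core := by
  classical
  let p : Fin n → Fin n := fun k => k - 1
  have hp : ∀ k, p (k + 1) = k := fun k => add_sub_cancel_right k 1
  -- The apex is found by walking back to the first core position; `t` guarantees that the walk
  -- ends.
  have hex : ∀ k, ∃ j, core (p^[j + 1] k) = true := by
    refine fin_cyclic_induction (t + 1) ⟨0, by simpa [hp] using ht⟩ ?_
    rintro k ⟨j, hj⟩
    refine ⟨j + 1, ?_⟩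
    rwa [Function.iterate_succ_apply, hp]
  refine ⟨⟨fun k => k + 1, core, fun k => p^[Nat.find (hex k) + 1] k, fun k => ?_,
    fin_eq_univ⟩, fun k => rfl, rfl⟩
  cases hc : core k
  · have : Nat.find (hex (k + 1)) = Nat.find (hex k) + 1 := by
      rw [Nat.find_eq_iff]
      constructor
      · rw [Function.iterate_succ_apply, hp]
        exact Nat.find_spec (hex k)
      · intro j hj
        rw [Function.iterate_succ_apply, hp]
        rcases j with _ | j
        · simp [hc]
        · exact Nat.find_min (hex k) (by omega)
    simp only [this, cond_false]
    rw [Function.iterate_succ_apply, hp]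
  · have : Nat.find (hex (k + 1)) = 0 := by
      rw [Nat.find_eq_zero]
      simpa [hp] using hc
    simp only [this, cond_true]
    exact hp k

/-! ### Wheels -/

section wheel

lemma wheel_adj_inl_inr {n : ℕ} (a : Fin 1) (b : Fin n) : (wheel n).Adj (.inl a) (.inr b) := by
  simp [wheel, join]

lemma wheel_adj_inr_inr {n : ℕ} (a b : Fin n) :
    (wheel n).Adj (.inr a) (.inr b) ↔ (cycleGraph n).Adj a b := by
  simp [wheel, join]

lemma wheel_not_adj_inl_inl {n : ℕ} (a b : Fin 1) : ¬ (wheel n).Adj (.inl a) (.inl b) := by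
  rw [Subsingleton.elim a b]
  exact SimpleGraph.irrefl _

theorem wheel_isIndContained {n : ℕ} (hn : 4 ≤ n) :
    (cycleGraph n).IsIndContained (triangleGraph (wheel n)) := by
  have : NeZero n := ⟨by omega⟩
  have hs := fin_add_ne hn
  have hadj := fun i j : Fin n => cycleGraph_adj_iff (show 2 ≤ n by omega) (i := i) (j := j)
  rw [isIndContained_triangleGraph_iff]
  have key : ∀ i j : Fin n, i ≠ j →
      (Shares ({.inl 0, .inr i, .inr (i + 1)} : Finset (Fin 1 ⊕ Fin n))
        {.inl 0, .inr j, .inr (j + 1)} ↔ j = i + 1 ∨ i = j + 1) := by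
    intro i j hij
    constructor
    · rintro ⟨a, b, hab, h1, h2, h3, h4⟩
      simp only [Finset.mem_insert, Finset.mem_singleton] at h1 h2 h3 h4
      rcases a with a | a <;> rcases b with b | b
      · exact absurd (by rw [Subsingleton.elim a b]) hab
      all_goals simp at h1 h2 h3 h4 hab; grind
    · rintro (rfl | rfl)
      · exact ⟨.inl 0, .inr (i + 1), by simp, by simp, by simp, by simp, by simp⟩
      · exact ⟨.inl 0, .inr (j + 1), by simp, by simp, by simp, by simp, by simp⟩
  refine ⟨fun i => {.inl 0, .inr i, .inr (i + 1)}, fun i j hij => ?_, fun i => ?_, fun i j hij => ?_⟩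
  · have hi : Sum.inr i ∈ ({.inl 0, .inr j, .inr (j + 1)} : Finset (Fin 1 ⊕ Fin n)) := by
      rw [← hij]; simp
    have hj : Sum.inr j ∈ ({.inl 0, .inr i, .inr (i + 1)} : Finset (Fin 1 ⊕ Fin n)) := by
      rw [hij]; simp
    have := hs i
    simp at hi hj
    grind
  · rw [mem_cliqueSet_iff, is3Clique_triple_iff]
    refine ⟨wheel_adj_inl_inr _ _, wheel_adj_inl_inr _ _, ?_⟩
    rw [wheel_adj_inr_inr, hadj]
    exact Or.inl rfl
  · rw [hadj, key i j hij]

end wheel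

/-! ### From an induced cycle to a wheel or a strip -/

section strip

variable {V : Type*} {G : SimpleGraph V} {n : ℕ} [NeZero n] {c : Fin n → Finset V}

/-- `q k` is the vertex of the `k`-th triangle that is not a vertex of the preceding one. -/
structure IsNewVertex (c : Fin n → Finset V) (q : Fin n → V) : Prop where
  mem : ∀ k, q k ∈ c k
  mem_next : ∀ k, q k ∈ c (k + 1)
  notMem : ∀ k, q (k + 1) ∉ c k
  mem_of_ne : ∀ k, ∀ y ∈ c (k + 1), y ≠ q (k + 1) → y ∈ c k

/-- Consecutive triangles have exactly two common vertices, which leaves one new vertex. It passes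
on to the next triangle: otherwise the edge common to `c k` and `c (k + 1)` would lie in `c (k - 1)`
too, and for `n ≥ 4` triangles two steps apart share no edge. -/
lemma IsTriCycle.exists_isNewVertex (hn : 4 ≤ n) (hc : IsTriCycle G c) :
    ∃ q, IsNewVertex c q := by
  classical
  have hs := fin_add_ne hn
  have hadj := fun i j : Fin n => cycleGraph_adj_iff (show 2 ≤ n by omega) (i := i) (j := j)
  have hcard : ∀ k, (c k).card = 3 := fun k => (mem_cliqueSet_iff.1 (hc.mem k)).card_eq
  have h1 : ∀ k, ∃ q ∈ c (k + 1), q ∉ c k ∧ ∀ y ∈ c (k + 1), y ≠ q → y ∈ c k := by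
    intro k
    obtain ⟨a, b, hab, ha, hb, ha', hb'⟩ := (hc.shares_iff k (k + 1) (hs k).1.symm).2
      ((hadj _ _).2 (Or.inl rfl))
    have hsub : {a, b} ⊆ c (k + 1) := by
      intro y hy; simp at hy; rcases hy with rfl | rfl <;> assumption
    have h2 : (c (k + 1) \ {a, b}).card = 1 := by
      rw [Finset.card_sdiff_of_subset hsub, hcard, Finset.card_pair hab]
    obtain ⟨q, hq⟩ := Finset.card_eq_one.1 h2
    have hq' : ∀ y, y ∈ c (k + 1) → y ≠ q → y ∈ c k := by
      intro y hy hyq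
      have : y ∉ c (k + 1) \ {a, b} := by rw [hq]; simpa using hyq
      simp [hy] at this
      by_cases hya : y = a
      · rwa [hya]
      · rwa [this hya]
    refine ⟨q, ?_, fun hqk => (hs k).1 (hc.injective ?_), hq'⟩
    · have : q ∈ c (k + 1) \ {a, b} := by rw [hq]; simp
      exact (Finset.mem_sdiff.1 this).1
    · refine Finset.eq_of_subset_of_card_le (fun y hy => ?_) (by rw [hcard, hcard])
      by_cases hyq : y = q
      · rwa [hyq]
      · exact hq' y hy hyq
  choose q hq using h1
  have hsub : ∀ k : Fin n, k - 1 + 1 = k := fun k => sub_add_cancel k 1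
  refine ⟨fun k => q (k - 1), fun k => ?_, fun k => ?_, fun k => ?_, fun k => ?_⟩
  · have := (hq (k - 1)).1
    rwa [hsub] at this
  · by_contra hnot
    obtain ⟨h2, h3, h4⟩ := hq (k - 1)
    rw [hsub] at h2 h4
    obtain ⟨a, b, hab, ha, hb, ha', hb'⟩ := (hc.shares_iff k (k + 1) (hs k).1.symm).2
      ((hadj _ _).2 (Or.inl rfl))
    have ha'' := h4 a ha (fun h => hnot (h ▸ ha'))
    have hb'' := h4 b hb (fun h => hnot (h ▸ hb'))
    have h5 := hs (k - 1)
    rw [hsub] at h5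
    have := (hc.shares_iff (k - 1) (k + 1) h5.2.1.symm).1 ⟨a, b, hab, ha'', hb'', ha', hb'⟩
    rw [hadj, hsub] at this
    rcases this with h | h
    · exact (hs k).1 h
    · exact h5.2.2 h.symm
  · have := (hq k).2.1
    rwa [add_sub_cancel_right]
  · have := (hq k).2.2
    rwa [add_sub_cancel_right]

lemma IsNewVertex.ne {q : Fin n → V} (hq : IsNewVertex c q) (k : Fin n) : q (k + 1) ≠ q k := by
  intro h
  exact hq.notMem k (h ▸ hq.mem k)

/-- The triangle `c (k + 1)` has the vertices `q (k + 1)`, `q k` and `z`. -/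
structure HasVertices (c : Fin n → Finset V) (q : Fin n → V) (k : Fin n) (z : V) : Prop where
  mem_iff : ∀ y, y ∈ c (k + 1) ↔ y = q (k + 1) ∨ y = q k ∨ y = z
  ne_left : z ≠ q (k + 1)
  ne_right : z ≠ q k

lemma IsNewVertex.exists_hasVertices {q : Fin n → V} (hq : IsNewVertex c q) (hc : IsTriCycle G c)
    (k : Fin n) : ∃ z, HasVertices c q k z := by
  classical
  have hcard : (c (k + 1)).card = 3 := (mem_cliqueSet_iff.1 (hc.mem (k + 1))).card_eq
  have hsub : {q (k + 1), q k} ⊆ c (k + 1) := by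
    intro y hy
    simp at hy
    rcases hy with rfl | rfl
    · exact hq.mem _
    · exact hq.mem_next _
  have h2 : (c (k + 1) \ {q (k + 1), q k}).card = 1 := by
    rw [Finset.card_sdiff_of_subset hsub, hcard, Finset.card_pair (hq.ne k)]
  obtain ⟨z, hz⟩ := Finset.card_eq_one.1 h2
  have hz' : z ∈ c (k + 1) \ {q (k + 1), q k} := by rw [hz]; simp
  simp at hz'
  refine ⟨z, fun y => ⟨fun hy => ?_, ?_⟩, hz'.2.1, hz'.2.2⟩
  · by_contra h
    have : y ∈ c (k + 1) \ {q (k + 1), q k} := by simp; tauto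
    rw [hz] at this
    simp at this
    tauto
  · rintro (rfl | rfl | rfl)
    · exact hq.mem _
    · exact hq.mem_next _
    · exact hz'.1

open scoped Classical in
-- The third vertex of `c (k + 2)` is not new, so it lies in `c (k + 1)`, and it is not `q (k + 1)`.
-- This leaves `q k` and `z`; if `q k` is present at all, it must be the third vertex.
lemma HasVertices.succ {q : Fin n → V} {k : Fin n} {z : V} (h : HasVertices c q k z)
    (hq : IsNewVertex c q) (hc : IsTriCycle G c) :
    HasVertices c q (k + 1) (if q k ∈ c (k + 1 + 1) then q k else z) := by
  obtain ⟨w, hw⟩ := hq.exists_hasVertices hc (k + 1)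
  have h1 : w ∈ c (k + 1 + 1) := (hw.mem_iff w).2 (by simp)
  have h2 := (h.mem_iff w).1 (hq.mem_of_ne _ w h1 hw.ne_left)
  have h3 := hw.ne_right
  have h4 := (hw.mem_iff (q k)).1
  have h5 : q k ≠ q (k + 1 + 1) := by
    intro h'
    exact hq.notMem (k + 1) (h' ▸ hq.mem_next k)
  have h6 := hq.ne k
  split_ifs with hk
  · rcases h4 hk with h' | h' | h'
    · exact absurd h' h5
    · exact absurd h'.symm h6
    · rwa [h']
  · rcases h2 with h' | h' | h'
    · exact absurd h' h3
    · exact absurd (h' ▸ h1) hk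
    · rwa [← h']

/-- Position `k` is core when `q k` still lies in `c (k + 2)`. Then the third vertices obey the
recursion of `apex`, and `q` carries the triangle `k` of the strip to `c (k + 1)`, with a shift by
one. Without core positions the third vertex is constant: the hub of a wheel. -/
theorem wheel_or_strip (hn : 4 ≤ n) (hc : IsTriCycle G c) :
    (wheel n).IsContained G ∨ ∃ (D : Strip (Fin n)) (t : Fin n) (q : Fin n → V),
      D.core t = true ∧ D.Proper ∧ EdgeInjective D.graph G q := by
  classical
  obtain ⟨q, hq⟩ := hc.exists_isNewVertex hn
  have hs := fin_add_ne hn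
  have hadj := fun i j : Fin n => cycleGraph_adj_iff (show 2 ≤ n by omega) (i := i) (j := j)
  by_cases hT : ∃ t, q t ∈ c (t + 1 + 1)
  · right
    obtain ⟨t, ht⟩ := hT
    obtain ⟨D, hnext, hcore⟩ := exists_strip (fun k => decide (q k ∈ c (k + 1 + 1))) t
      (by simpa using ht)
    have hcore' : ∀ k, D.core k = decide (q k ∈ c (k + 1 + 1)) := fun k => by rw [hcore]
    have hv : ∀ k, HasVertices c q k (q (D.apex k)) := by
      refine fin_cyclic_induction (t + 1) ?_ fun k hk => ?_
      · obtain ⟨z, hz⟩ := hq.exists_hasVertices hc t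
        have := hz.succ hq hc
        rw [if_pos ht] at this
        have ha : D.apex (t + 1) = t := by
          rw [← hnext, Strip.apex_next_of_core (by simpa [hcore'] using ht)]
        rwa [ha]
      · have := hk.succ hq hc
        rw [← hnext k, D.apex_next, hcore']
        rw [hnext]
        by_cases h : q k ∈ c (k + 1 + 1) <;> simpa [h] using this
    have htri : ∀ k a, a ∈ D.tri k → q a ∈ c (k + 1) := by
      intro k a ha
      rw [Strip.mem_tri, hnext] at ha
      rw [(hv k).mem_iff]
      rcases ha with rfl | rfl | rfl <;> simp
    have hinj : ∀ k a b, a ∈ D.tri k → b ∈ D.tri k → q a = q b → a = b := by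
      intro k a b ha hb
      rw [Strip.mem_tri, hnext] at ha hb
      have h1 := (hv k).ne_left
      have h2 := (hv k).ne_right
      have h3 := hq.ne k
      grind
    have hcons : ∀ k l, k ≠ l → Shares (c (k + 1)) (c (l + 1)) → l = D.next k ∨ k = D.next l := by
      intro k l hkl h
      rw [hc.shares_iff _ _ (fun h => hkl (add_right_cancel h)), hadj] at h
      rw [hnext, hnext]
      exact h.imp add_right_cancel add_right_cancel
    refine ⟨D, t, q, by simpa [hcore'] using ht, ⟨fun k h => (hv k).ne_right (by rw [h]), ?_⟩, ?_, ?_⟩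
    · rintro k l hkl ⟨a, b, hab, h1, h2, h3, h4⟩
      exact hcons k l hkl ⟨q a, q b, fun h => hab (hinj k a b h1 h2 h), htri _ _ h1, htri _ _ h2,
        htri _ _ h3, htri _ _ h4⟩
    all_goals
      have hedge : ∀ {a b}, D.graph.Adj a b → ∃ k, a ∈ D.tri k ∧ b ∈ D.tri k ∧ a ≠ b := by
        intro a b h
        obtain ⟨⟨e, k, he⟩, hab⟩ := Strip.graph_adj.1 h
        refine ⟨k, ?_, ?_, hab⟩ <;> rw [Strip.mem_tri] <;>
        · cases e <;> simp only [Strip.edge, cond_true, cond_false, Sym2.eq_iff] at he <;> tauto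
    · intro a b h
      obtain ⟨k, ha, hb, hab⟩ := hedge h
      exact adj_of_mem_clique (hc.mem (k + 1)) (htri _ _ ha) (htri _ _ hb)
        fun h => hab (hinj k a b ha hb h)
    · intro a b a' b' h h' haa hbb
      obtain ⟨k, ha, hb, hab⟩ := hedge h
      obtain ⟨l, ha', hb', -⟩ := hedge h'
      -- Of the triangle `c (k + 2)`, only the newest vertex is outside `c (k + 1)`. So `a'` already
      -- lies on the triangle `k` of the strip, on which `q` is injective.
      have hstep : ∀ k a a', a ∈ D.tri k → a' ∈ D.tri (D.next k) → q a = q a' → a = a' := by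
        intro k a a' ha ha' haa
        refine hinj k a a' ha ?_ haa
        rw [Strip.mem_tri] at ha'
        rcases ha' with h | h | h
        · refine absurd (htri k a ha) ?_
          rw [haa, h, hnext, hnext]
          exact hq.notMem _
        · exact h ▸ (Strip.tri_inter_left k).1
        · exact h ▸ (Strip.tri_inter_left k).2
      by_cases hkl : k = l
      · subst hkl
        exact hinj k a a' ha ha' haa
      · rcases hcons k l hkl ⟨q a, q b, fun h => hab (hinj k a b ha hb h), htri _ _ ha, htri _ _ hb,
          haa ▸ htri _ _ ha', hbb ▸ htri _ _ hb'⟩ with rfl | rfl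
        · exact hstep k a a' ha ha' haa
        · exact (hstep l a' a ha' ha haa.symm).symm
  · left
    push Not at hT
    obtain ⟨z, hz⟩ := hq.exists_hasVertices hc 0
    have hv : ∀ k, HasVertices c q k z := by
      refine fin_cyclic_induction 0 hz fun k hk => ?_
      have := hk.succ hq hc
      rwa [if_neg (hT k)] at this
    have hmem : ∀ k, z ∈ c k ∧ z ∈ c (k + 1) := by
      have : ∀ k, z ∈ c (k + 1) := fun k => ((hv k).mem_iff z).2 (by simp)
      intro k
      refine ⟨?_, this k⟩
      have := this (k - 1)
      rwa [sub_add_cancel] at this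
    -- If `q k = q l`, the spoke from `z` to this vertex lies in `c (k + 1)` and `c (l + 1)`. Thus
    -- `k` and `l` are consecutive, but consecutive new vertices differ.
    have hqinj : Function.Injective q := by
      intro k l hkl
      by_contra hne
      have h := (hc.shares_iff (k + 1) (l + 1) fun h => hne (add_right_cancel h)).1
        ⟨z, q k, (hv k).ne_right, (hmem k).2, hq.mem_next k, (hmem l).2, hkl ▸ hq.mem_next l⟩
      rw [hadj] at h
      rcases h with h | h
      · have := add_right_cancel h
        exact hq.ne k (by rw [← this, hkl])
      · have := add_right_cancel h
        exact hq.ne l (by rw [← this, hkl])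
    refine ⟨⟨Sum.elim (fun _ => z) q, ?_⟩, ?_⟩
    · have hzq : ∀ k, G.Adj z (q k) := fun k =>
        adj_of_mem_clique (hc.mem k) (hmem k).1 (hq.mem k) (hv k).ne_right
      have hqq : ∀ k, G.Adj (q (k + 1)) (q k) := fun k =>
        adj_of_mem_clique (hc.mem (k + 1)) (hq.mem (k + 1)) (hq.mem_next k) (hq.ne k)
      rintro (a | a) (b | b) hab
      · exact absurd hab (wheel_not_adj_inl_inl a b)
      · exact hzq b
      · exact (hzq a).symm
      · rw [wheel_adj_inr_inr, hadj] at hab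
        rcases hab with rfl | rfl
        · exact (hqq a).symm
        · exact hqq b
    · rintro (a | a) (b | b) hab
      · rw [Subsingleton.elim a b]
      · exact absurd hab (hv b).ne_right
      · exact absurd hab.symm (hv a).ne_right
      · exact congrArg _ (hqinj hab)

end strip

/-! ### Triangles in the triangle graph -/

section three

variable {V : Type*} {G : SimpleGraph V}

lemma K4_isContained {a b x y : V} (hab : G.Adj a b) (hax : G.Adj a x) (hay : G.Adj a y)
    (hbx : G.Adj b x) (hby : G.Adj b y) (hxy : G.Adj x y) : (K 4).IsContained G := by
  refine ⟨⟨![a, b, x, y], ?_⟩, ?_⟩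
  · intro i j hij
    fin_cases i <;> fin_cases j <;> simp_all [adj_comm]
  · intro i j hij
    by_contra hne
    have := hab.ne; have := hax.ne; have := hay.ne; have := hbx.ne; have := hby.ne
    have := hxy.ne
    fin_cases i <;> fin_cases j <;> simp_all

lemma K5MinusK3_adj {a b : Fin 5} : K5MinusK3.Adj a b ↔ a ≠ b ∧ ¬ (a.1 < 3 ∧ b.1 < 3) := by
  rw [K5MinusK3, completeMinus, sdiff_adj, top_adj, map_adj']
  revert a b
  decide

lemma K5MinusK3_isContained {a b x y z : V} (hab : G.Adj a b) (hax : G.Adj a x) (hay : G.Adj a y)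
    (haz : G.Adj a z) (hbx : G.Adj b x) (hby : G.Adj b y) (hbz : G.Adj b z) (hxy : x ≠ y)
    (hxz : x ≠ z) (hyz : y ≠ z) : K5MinusK3.IsContained G := by
  refine ⟨⟨![x, y, z, a, b], ?_⟩, ?_⟩
  · intro i j hij
    rw [K5MinusK3_adj] at hij
    fin_cases i <;> fin_cases j <;> simp_all [adj_comm]
  · intro i j hij
    by_contra hne
    have := hab.ne; have := hax.ne; have := hay.ne; have := hbx.ne; have := hby.ne
    have := haz.ne; have := hbz.ne
    fin_cases i <;> fin_cases j <;> simp_all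

lemma shares_iff_of_decidable {W : Type*} [DecidableEq W] {s t : Finset W} :
    Shares s t ↔ ∃ a ∈ s, ∃ b ∈ s, a ≠ b ∧ a ∈ t ∧ b ∈ t := by
  constructor
  · rintro ⟨a, b, h1, h2, h3, h4, h5⟩
    exact ⟨a, h2, b, h3, h1, h4, h5⟩
  · rintro ⟨a, h2, b, h3, h1, h4, h5⟩
    exact ⟨a, b, h1, h2, h3, h4, h5⟩

lemma K4_isIndContained : (cycleGraph 3).IsIndContained (triangleGraph (K 4)) := by
  rw [isIndContained_triangleGraph_iff]
  refine ⟨![{0, 1, 2}, {0, 1, 3}, {0, 2, 3}], by decide, ?_, ?_⟩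
  · intro i
    fin_cases i <;> simp [is3Clique_triple_iff]
  · simp only [shares_iff_of_decidable]
    decide

lemma K5MinusK3_isIndContained :
    (cycleGraph 3).IsIndContained (triangleGraph K5MinusK3) := by
  rw [isIndContained_triangleGraph_iff]
  refine ⟨![{0, 3, 4}, {1, 3, 4}, {2, 3, 4}], by decide, ?_, ?_⟩
  · intro i
    fin_cases i <;> simp [is3Clique_triple_iff, K5MinusK3_adj]
  · simp only [shares_iff_of_decidable]
    decide

lemma exists_eq_of_mem_clique {s : Finset V} (hs : s ∈ G.cliqueSet 3) {a b : V} (ha : a ∈ s)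
    (hb : b ∈ s) (hab : a ≠ b) :
    ∃ x, x ≠ a ∧ x ≠ b ∧ G.Adj a b ∧ G.Adj a x ∧ G.Adj b x ∧
      ∀ y, y ∈ s ↔ y = a ∨ y = b ∨ y = x := by
  classical
  have hsub : {a, b} ⊆ s := by
    intro y hy
    simp at hy
    rcases hy with rfl | rfl <;> assumption
  have h2 : (s \ {a, b}).card = 1 := by
    rw [Finset.card_sdiff_of_subset hsub, (mem_cliqueSet_iff.1 hs).card_eq, Finset.card_pair hab]
  obtain ⟨x, hx⟩ := Finset.card_eq_one.1 h2
  have hx' : ∀ y, (y ∈ s ∧ ¬ (y = a ∨ y = b)) ↔ y = x := by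
    intro y
    have := Finset.ext_iff.1 hx y
    simpa using this
  obtain ⟨hxs, hxab⟩ := (hx' x).2 rfl
  rw [not_or] at hxab
  refine ⟨x, hxab.1, hxab.2, adj_of_mem_clique hs ha hb hab, adj_of_mem_clique hs ha hxs (Ne.symm hxab.1),
    adj_of_mem_clique hs hb hxs (Ne.symm hxab.2), fun y => ⟨fun hy => ?_, ?_⟩⟩
  · have := hx' y
    tauto
  · rintro (rfl | rfl | rfl) <;> assumption

/-- Let `ab` be the common edge of the first two triangles and `x`, `y` their third vertices. If the
last triangle contains `ab`, the three third vertices give `K_5 - K_3`. If not, it must contain both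
`x` and `y` to share edges with the others, and `a`, `b`, `x`, `y` span `K_4`. -/
theorem isIndContained_three_iff : (cycleGraph 3).IsIndContained (triangleGraph G) ↔
    (K 4).IsContained G ∨ K5MinusK3.IsContained G := by
  constructor
  · rw [isIndContained_triangleGraph_iff]
    rintro ⟨c, hc⟩
    have hsh : ∀ i j, i ≠ j → Shares (c i) (c j) := by
      intro i j hij
      rw [hc.shares_iff i j hij, cycleGraph_three_eq_top]
      exact hij
    have hne : ∀ i j, i ≠ j → ¬ ∀ y, y ∈ c i ↔ y ∈ c j :=
      fun i j hij h => hij (hc.injective (Finset.ext h))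
    obtain ⟨a, b, hab, ha0, hb0, ha1, hb1⟩ := hsh 0 1 (by decide)
    obtain ⟨x, hxa, hxb, h1, h2, h3, hx⟩ := exists_eq_of_mem_clique (hc.mem 0) ha0 hb0 hab
    obtain ⟨y, hya, hyb, -, h5, h6, hy⟩ := exists_eq_of_mem_clique (hc.mem 1) ha1 hb1 hab
    have hxy : x ≠ y := by
      rintro rfl
      exact hne 0 1 (by decide) fun w => (hx w).trans (hy w).symm
    by_cases hab2 : a ∈ c 2 ∧ b ∈ c 2
    · obtain ⟨z, -, -, -, h8, h9, hz⟩ := exists_eq_of_mem_clique (hc.mem 2) hab2.1 hab2.2 hab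
      have hxz : x ≠ z := by
        rintro rfl
        exact hne 0 2 (by decide) fun w => (hx w).trans (hz w).symm
      have hyz : y ≠ z := by
        rintro rfl
        exact hne 1 2 (by decide) fun w => (hy w).trans (hz w).symm
      exact Or.inr (K5MinusK3_isContained h1 h2 h5 h8 h3 h6 h9 hxy hxz hyz)
    · have key : ∀ i w, (∀ y, y ∈ c i ↔ y = a ∨ y = b ∨ y = w) → i ≠ 2 → w ∈ c 2 := by
        intro i w hw hi
        obtain ⟨p, r, hpr, hp, hr, hp2, hr2⟩ := hsh i 2 hi
        rw [hw] at hp hr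
        grind
      exact Or.inl (K4_isContained h1 h2 h5 h3 h6
        (adj_of_mem_clique (hc.mem 2) (key 0 x hx (by decide)) (key 1 y hy (by decide)) hxy))
  · rintro (h | h)
    · exact isIndContained_of_isContained h K4_isIndContained
    · exact isIndContained_of_isContained h K5MinusK3_isIndContained

end three

/-! ### Cycles in the base graphs, and assembly -/

lemma ObtainedBySplittings.nonempty_iso {V W : Type} {m k : ℕ} {B : SimpleGraph V}
    {H : SimpleGraph W} {S : Set (Finset W)} (h : ObtainedBySplittings m B k H S) (hk : k = 0) :
    Nonempty (B ≃g H) := by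
  cases h with
  | start h _ => exact h
  | step _ _ => omega

lemma isIndContained_of_valid {V : Type*} {n : ℕ} {B : SimpleGraph V} {D : Strip (Fin n)}
    (h : D.Valid) (hB : Nonempty (B ≃g D.graph)) :
    (cycleGraph n).IsIndContained (triangleGraph B) := by
  obtain ⟨f⟩ := hB
  have := h.isInducedTriangleCycle.isIndContained
  rw [Nat.card_fin] at this
  exact isIndContained_of_isContained ⟨f.symm.toCopy⟩ this

/-- The strip with only core letters needs no splittings, so the reduction identifies its graph with
the cycle square. -/
theorem cycleSquare_isIndContained {m : ℕ} (hm : 5 ≤ m) :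
    (cycleGraph m).IsIndContained (triangleGraph (cycleSquare m)) := by
  have : NeZero m := ⟨by omega⟩
  obtain ⟨D, -, hcore⟩ := exists_strip (fun _ : Fin m => true) 0 rfl
  obtain ⟨hv, -, ho⟩ := Strip.obtained_of_five_le hm (Fin m) D (by simp [hcore])
  exact isIndContained_of_valid hv (ho.nonempty_iso (by simp))

theorem K6MinusK3_isIndContained : (cycleGraph 6).IsIndContained (triangleGraph K6MinusK3) := by
  obtain ⟨D, hnext, hcore⟩ := exists_strip ![true, false, true, false, true, false] 0 rfl
  obtain ⟨hv, hB⟩ := Strip.base_K6MinusK3 (D := D) (Nat.card_fin 6) (w := 1) (by rw [hcore]; rfl) (by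
    simp only [hnext, hcore]; decide)
  exact isIndContained_of_valid hv hB

theorem K6MinusP4_isIndContained : (cycleGraph 6).IsIndContained (triangleGraph K6MinusP4) := by
  -- The word found in `Strip.base_K6MinusP4`, with `y` at 0 and `x` at 4.
  obtain ⟨D, hnext, hcore⟩ := exists_strip ![false, true, true, true, false, true] 1 rfl
  have ha : ∀ k, D.apex (k + 1) = bif D.core k then k else D.apex k := fun k => by
    rw [← hnext, D.apex_next]
  have a4 := ha 3
  have a5 := ha 4
  have a0 := ha 5
  simp [hcore] at a4 a5 a0
  obtain ⟨hv, hB⟩ := Strip.base_K6MinusP4 (D := D) (Nat.card_fin 6) (x := 4) (y := 0)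
    (by rw [hcore]; rfl) (by rw [hcore]; rfl) (by decide) (by rw [hcore]; decide)
    (by rw [a0, a5, a4])
  exact isIndContained_of_valid hv hB

lemma cycleSquare_five : cycleSquare 5 = K 5 := by
  ext a b
  rw [cycleSquare_adj (by norm_num), top_adj]
  revert a b
  decide

/-- In a valid strip, closed neighbourhoods have at least four elements. -/
lemma Strip.Valid.exists_four {W : Type*} {D : Strip W} (h : D.Valid) (u : W) :
    ∃ s : Finset W, s.card = 4 ∧ ∀ a ∈ s, a = u ∨ D.graph.Adj u a := by
  classical
  obtain ⟨p, rfl⟩ := D.next_surjective u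
  have h1 := h.next_ne p
  have h2 := h.next_ne (D.next p)
  have h3 := h.next_ne_apex p
  have h4 := h.apex_ne p
  have h5 : D.next (D.next p) ≠ p := by
    intro e
    exact h1 (h.edge_inj false (D.next p) false p (by simp [edge, e, Sym2.eq_swap])).2
  have h6 : D.next (D.next p) ≠ D.apex p := by
    intro e
    exact h1 (h.edge_inj false (D.next p) true p (by simp [edge, e, Sym2.eq_swap])).2
  refine ⟨{D.next p, p, D.apex p, D.next (D.next p)}, ?_, ?_⟩
  · rw [Finset.card_insert_of_notMem, Finset.card_insert_of_notMem, Finset.card_pair h6.symm]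
    · simp [h4.symm, h5.symm]
    · simp [h1, h2.symm, h3]
  · intro a ha
    simp only [Finset.mem_insert, Finset.mem_singleton] at ha
    rw [h.graph_adj]
    rcases ha with rfl | rfl | rfl | rfl
    · exact Or.inl rfl
    · exact Or.inr ⟨false, a, rfl⟩
    · exact Or.inr ⟨true, p, rfl⟩
    · exact Or.inr ⟨false, _, Sym2.eq_swap⟩

/-- Two vertices with the same image have disjoint closed neighbourhoods, each with at least four
elements. This is why no stickings occur below eight vertices. -/
lemma EdgeInjective.injective_of_card {W V : Type*} [Finite W] {D : Strip W} {G : SimpleGraph V}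
    {q : W → V} (h : EdgeInjective D.graph G q) (hv : D.Valid) (hW : Nat.card W < 8) :
    Function.Injective q := by
  classical
  intro u v huv
  by_contra hne
  obtain ⟨s, hs, hsu⟩ := hv.exists_four u
  obtain ⟨t, ht, htv⟩ := hv.exists_four v
  have hnot : ¬ D.graph.Adj u v := fun hadj => (h.map_adj hadj).ne huv
  have hdisj : Disjoint s t := by
    rw [Finset.disjoint_left]
    intro a hs ht
    rcases hsu a hs with rfl | h1 <;> rcases htv a ht with rfl | h2
    · exact hne rfl
    · exact hnot h2.symm
    · exact hnot h1
    · exact hne (h.eq_left h1 h2 huv rfl)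
  have := Fintype.ofFinite W
  have hle := Finset.card_le_univ (s ∪ t)
  rw [Finset.card_union_of_disjoint hdisj, hs, ht, ← Nat.card_eq_fintype_card] at hle
  omega

/-- An induced cycle of the triangle graph comes from a wheel or from the graph of a strip. -/
theorem wheel_or_obtained {V : Type*} {G : SimpleGraph V} {n : ℕ} (hn : 4 ≤ n)
    (h : (cycleGraph n).IsIndContained (triangleGraph G)) :
    (wheel n).IsContained G ∨ ∃ (F : SimpleGraph (Fin n)) (q : Fin n → V),
      EdgeInjective F G q ∧ (n < 8 → F.IsContained G) ∧
      ((∃ m, 5 ≤ m ∧ m ≤ n ∧ ∃ S, ObtainedBySplittings m (cycleSquare m) (n - m) F S) ∨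
        6 ≤ n ∧ (∃ S, ObtainedBySplittings 6 K6MinusK3 (n - 6) F S) ∨
        6 ≤ n ∧ (∃ S, ObtainedBySplittings 6 K6MinusP4 (n - 6) F S)) := by
  have : NeZero n := ⟨by omega⟩
  obtain ⟨c, hc⟩ := isIndContained_triangleGraph_iff.1 h
  refine (wheel_or_strip hn hc).imp_right ?_
  rintro ⟨D, t, q, ht, hp, hq⟩
  obtain ⟨hv, hcl⟩ := hp.classification (by rwa [Nat.card_fin]) ht
  rw [Nat.card_fin] at hcl
  refine ⟨D.graph, q, hq, fun h8 => ⟨⟨q, fun hab => hq.map_adj hab⟩,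
    hq.injective_of_card hv (by rwa [Nat.card_fin])⟩, ?_⟩
  rcases hcl with ⟨m, h1, h2, h3⟩ | ⟨h1, h2⟩ | ⟨h1, h2⟩
  · exact Or.inl ⟨m, h1, h2, _, h3⟩
  · exact Or.inr (Or.inl ⟨h1, _, h2⟩)
  · exact Or.inr (Or.inr ⟨h1, _, h2⟩)

theorem IsSplitForbidden.isIndContained {n : ℕ} (hn : 6 ≤ n) {W : Type} {F : SimpleGraph W}
    (h : IsSplitForbidden n F) : (cycleGraph n).IsIndContained (triangleGraph F) := by
  rcases h with ⟨m, h5, hmn, S, h⟩ | ⟨S, h⟩ | ⟨S, h⟩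
  · have := (h.isInducedTriangleCycle (by omega)).isIndContained
    rwa [Nat.add_sub_cancel' hmn] at this
  all_goals
    have := (h.isInducedTriangleCycle (by omega)).isIndContained
    rwa [Nat.add_sub_cancel' hn] at this

end TriangleGraphs

/-! ### The theorem -/

open TriangleGraphs

theorem theorem3p6 {V : Type*} (G : SimpleGraph V) :
    -- case a
    (¬ (cycleGraph 3).IsIndContained (TriangleGraphs.triangleGraph G) ↔
      ¬ (TriangleGraphs.K 4).IsContained G ∧ ¬ TriangleGraphs.K5MinusK3.IsContained G) ∧
    -- case b
    (¬ (cycleGraph 4).IsIndContained (TriangleGraphs.triangleGraph G) ↔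
      ¬ (TriangleGraphs.wheel 4).IsContained G) ∧
    -- case c
    (Nonempty (TriangleGraphs.cycleSquare 5 ≃g TriangleGraphs.K 5) ∧
      (¬ (cycleGraph 5).IsIndContained (TriangleGraphs.triangleGraph G) ↔
        ¬ (TriangleGraphs.wheel 5).IsContained G ∧ ¬ (TriangleGraphs.K 5).IsContained G)) ∧
    -- case d
    (¬ (cycleGraph 6).IsIndContained (TriangleGraphs.triangleGraph G) ↔
      ¬ (TriangleGraphs.wheel 6).IsContained G ∧
      ¬ (TriangleGraphs.cycleSquare 6).IsContained G ∧
      ¬ TriangleGraphs.K6MinusK3.IsContained G ∧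
      ¬ TriangleGraphs.K6MinusP4.IsContained G ∧
      ∀ (W : Type) (F : SimpleGraph W) (S : Set (Finset W)),
        TriangleGraphs.ObtainedBySplittings 5 (TriangleGraphs.cycleSquare 5) 1 F S →
          ¬ F.IsContained G) ∧
    -- case e
    (∀ n : ℕ, 7 ≤ n →
      (¬ (cycleGraph n).IsIndContained (TriangleGraphs.triangleGraph G) ↔
        ¬ (TriangleGraphs.wheel n).IsContained G ∧
        ∀ (W W' : Type) (F : SimpleGraph W) (F' : SimpleGraph W'),
          TriangleGraphs.IsSplitForbidden n F → TriangleGraphs.ObtainedByStickings F F' →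
            ¬ F'.IsContained G)) := by
  refine ⟨?_, ?_, ⟨⟨cycleSquare_five ▸ Iso.refl⟩, ?_⟩, ?_, ?_⟩
  · rw [isIndContained_three_iff, not_or]
  · rw [not_iff_not]
    refine ⟨fun h => ?_, fun h => isIndContained_of_isContained h (wheel_isIndContained le_rfl)⟩
    -- Every strip graph in the classification needs `n ≥ 5`, so only the wheel remains.
    rcases wheel_or_obtained le_rfl h with h | ⟨F, q, -, -, ⟨m, h1, h2, -⟩ | ⟨h1, -⟩ | ⟨h1, -⟩⟩
    · exact h
    all_goals omega
  · rw [← not_or, not_iff_not, ← cycleSquare_five]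
    constructor
    · intro h
      rcases wheel_or_obtained (by norm_num) h with
        h | ⟨F, q, -, hF, ⟨m, h1, h2, S, hS⟩ | ⟨h1, -⟩ | ⟨h1, -⟩⟩
      · exact Or.inl h
      · obtain rfl : m = 5 := by omega
        obtain ⟨f⟩ := hS.nonempty_iso rfl
        exact Or.inr (IsContained.trans ⟨f.toCopy⟩ (hF (by norm_num)))
      all_goals omega
    · rintro (h | h)
      · exact isIndContained_of_isContained h (wheel_isIndContained (by norm_num))
      · exact isIndContained_of_isContained h (cycleSquare_isIndContained le_rfl)
  · constructor
    · intro h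
      refine ⟨fun h' => h ?_, fun h' => h ?_, fun h' => h ?_, fun h' => h ?_,
        fun W F S hS h' => h ?_⟩
      · exact isIndContained_of_isContained h' (wheel_isIndContained (by norm_num))
      · exact isIndContained_of_isContained h' (cycleSquare_isIndContained (by norm_num))
      · exact isIndContained_of_isContained h' K6MinusK3_isIndContained
      · exact isIndContained_of_isContained h' K6MinusP4_isIndContained
      · exact isIndContained_of_isContained h'
          (hS.isInducedTriangleCycle (by norm_num)).isIndContained
    · rintro ⟨hw, h6, hK3, hP4, h5⟩ h
      rcases wheel_or_obtained (by norm_num) h with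
        h | ⟨F, q, -, hF, ⟨m, h1, h2, S, hS⟩ | ⟨-, S, hS⟩ | ⟨-, S, hS⟩⟩
      · exact hw h
      · obtain rfl | rfl : m = 5 ∨ m = 6 := by omega
        · exact h5 _ F S hS (hF (by norm_num))
        · obtain ⟨f⟩ := hS.nonempty_iso rfl
          exact h6 (IsContained.trans ⟨f.toCopy⟩ (hF (by norm_num)))
      · obtain ⟨f⟩ := hS.nonempty_iso rfl
        exact hK3 (IsContained.trans ⟨f.toCopy⟩ (hF (by norm_num)))
      · obtain ⟨f⟩ := hS.nonempty_iso rfl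
        exact hP4 (IsContained.trans ⟨f.toCopy⟩ (hF (by norm_num)))
  · intro n hn
    constructor
    · intro h
      refine ⟨fun h' => h ?_, fun W W' F F' hF hF' h' => h ?_⟩
      · exact isIndContained_of_isContained h' (wheel_isIndContained (by omega))
      · exact isIndContained_of_isContained h' (hF'.isIndContained (hF.isIndContained (by omega)))
    · rintro ⟨hw, hs⟩ h
      rcases wheel_or_obtained (by omega) h with h | ⟨F, q, hq, -, hF⟩
      · exact hw h
      · obtain ⟨X, H, hH, hHG⟩ := hq.exists_stickings (F₀ := F) .refl
        exact hs _ _ F H (hF.imp_right (Or.imp And.right And.right)) hH hHG
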